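/- Let $v_1,\dots,v_K\in\mathbb{R}^3$ be the (distinct) vertices of a non-degenerate convex polyhedron $\Gamma=\operatorname{conv}\{v_1,\dots,v_K\}$, i.e. each $v_k$ is a vertex of $\Gamma$ and the $v_k$ do not lie in a plane, and let $g$ be the indicator function of $\Gamma$. Let $u_x,u_y\in\mathbb{R}^3$ be unit vectors such that $d=u_x\times u_y$ is a unit vector, and let $s_x,s_y\in\mathbb{R}$. Assume that $v_k-v_{k'}$ is not collinear with $d$ for $k\ne k'$. Let $$I(x,y)=\int_{\mathbb{R}} g\big((x-s_x)u_x+(y-s_y)u_y+t\,d\big)\,dt$$ be the parallel-beam projection of $g$ along $d$ with shifts $s_x,s_y$, let $P=\{(r\cdot u_x+s_x)+i(r\cdot u_y+s_y): r\in\Gamma\}\subset\mathbb{C}$ be the projection area, let $z_k=(v_k\cdot u_x+s_x)+i(v_k\cdot u_y+s_y)$ be the projected vertices, and let $\Pi$ be a closed rectangle with sides parallel to the axes which contains $P$ (identifying $\mathbb{R}^2$ with $\mathbb{C}$). Then there exist coefficients $\rho_1,\dots,\rho_K\in\mathbb{C}$ such that, for every complex function $h$ that is analytic at every point of $P$, the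 function $I(x,y)\,h'''(x+iy)$ is integrable on $\Pi$ and $$\iint_{\Pi} I(x,y)\,h'''(x+iy)\,dx\,dy=\sum_{k=1}^{K}\rho_k\,h(z_k).$$ Moreover, the $\rho_k$ are explicit. The boundary of $\Gamma$ can be triangulated by non-degenerate triangles with vertices among the $v_k$ which have pairwise disjoint relative interiors; and for every such triangulation, listing each triangle once as an ordered triple $(a,b,c)$ of indices such that $n_{abc}=(v_b-v_a)\times(v_c-v_a)$ points out of $\Gamma$, $$\rho_k=\sum_{\text{triangles with vertices } v_k,v_l,v_m}\frac{n\cdot u_x-i\,n\cdot u_y}{2\,(z_k-z_l)(z_k-z_m)},$$ where $n$ is the outward normal $n_{abc}$ of the triangle and $v_l,v_m$ are its two vertices other than $v_k$. -/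

import Mathlib

open scoped Matrix

noncomputable section

namespace ParallelBeam

/-- The solid convex polyhedron spanned by the points `v k`. -/
def body {K : ℕ} (v : Fin K → Fin 3 → ℝ) : Set (Fin 3 → ℝ) :=
  convexHull ℝ (Set.range v)

/-- The bilevel polyhedron model: `1` on the solid polyhedron and `0` elsewhere. -/
def model {K : ℕ} (v : Fin K → Fin 3 → ℝ) : (Fin 3 → ℝ) → ℝ :=
  (body v).indicator 1

/-- The point of the projection plane, in window coordinates `(x, y)`, below the point `r`. -/
def proj (ux uy : Fin 3 → ℝ) (sx sy : ℝ) (r : Fin 3 → ℝ) : ℝ × ℝ :=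
  (r ⬝ᵥ ux + sx, r ⬝ᵥ uy + sy)

/-- A point of the plane, as a complex number `x + i y`. -/
def toComplex (p : ℝ × ℝ) : ℂ := (p.1 : ℂ) + Complex.I * (p.2 : ℂ)

/-- The parallel-beam projection `I(x, y)`: the integral of the model along the line of all `r`
with `r · ux + sx = x` and `r · uy + sy = y`. For orthonormal `ux`, `uy`, this line is parametrized
by arc length as `(x - sx) ux + (y - sy) uy + t (ux × uy)`. -/
def beam {K : ℕ} (v : Fin K → Fin 3 → ℝ) (ux uy : Fin 3 → ℝ) (sx sy : ℝ) (p : ℝ × ℝ) : ℝ :=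
  ∫ t : ℝ, model v ((p.1 - sx) • ux + (p.2 - sy) • uy + t • (ux ⨯₃ uy))

/-- The closed rectangle with centre `c` and side lengths `Rx`, `Ry`. -/
def window (c : ℝ × ℝ) (Rx Ry : ℝ) : Set (ℝ × ℝ) :=
  Set.Icc (c.1 - Rx / 2) (c.1 + Rx / 2) ×ˢ Set.Icc (c.2 - Ry / 2) (c.2 + Ry / 2)

/-- The projected vertex `z k`, as a complex number. -/
def zVertex {K : ℕ} (v : Fin K → Fin 3 → ℝ) (ux uy : Fin 3 → ℝ) (sx sy : ℝ) (k : Fin K) : ℂ :=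
  toComplex (proj ux uy sx sy (v k))

/-- The (non-normalized) normal `(b - a) × (c - a)` of the oriented triangle `a b c`. -/
def triNormal (a b c : Fin 3 → ℝ) : Fin 3 → ℝ := (b - a) ⨯₃ (c - a)

/-- The relative interior of the triangle `a b c`. -/
def openTriangle (a b c : Fin 3 → ℝ) : Set (Fin 3 → ℝ) :=
  {r | ∃ α β γ : ℝ, 0 < α ∧ 0 < β ∧ 0 < γ ∧ α + β + γ = 1 ∧ r = α • a + β • b + γ • c}

/-- `T` is a triangulation of the boundary surface of the polyhedron by triangles
with vertices among the `v k`, each listed once and oriented outward. -/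
structure IsBoundaryTriangulation {K : ℕ} (v : Fin K → Fin 3 → ℝ)
    (T : Finset (Fin K × Fin K × Fin K)) : Prop where
  /-- The triangles are nondegenerate. -/
  nondeg : ∀ t ∈ T, triNormal (v t.1) (v t.2.1) (v t.2.2) ≠ 0
  /-- The normals point outward: the polyhedron lies on the negative side of each triangle. -/
  outward : ∀ t ∈ T, ∀ i, triNormal (v t.1) (v t.2.1) (v t.2.2) ⬝ᵥ (v i - v t.1) ≤ 0
  /-- The triangles make up the whole boundary. -/
  cover : ⋃ t ∈ T, convexHull ℝ {v t.1, v t.2.1, v t.2.2} = frontier (body v)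
  /-- Different triangles do not overlap. -/
  disjoint : ∀ t ∈ T, ∀ t' ∈ T, t ≠ t' →
    Disjoint (openTriangle (v t.1) (v t.2.1) (v t.2.2))
      (openTriangle (v t'.1) (v t'.2.1) (v t'.2.2))

/-- Half of `n · conj u` for `u = ux + i uy`, where `n` is the normal of the triangle `a b c`. -/
def flux (ux uy a b c : Fin 3 → ℝ) : ℂ :=
  (((triNormal a b c ⬝ᵥ ux : ℝ) : ℂ) - Complex.I * ((triNormal a b c ⬝ᵥ uy : ℝ) : ℂ)) / 2

/-- The coefficient of `h (z k)` which the triangles of `T` having `v k` as a vertex contribute.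
The three summands are for `v k` being the first, second or third vertex listed. -/
def coeff {K : ℕ} (v : Fin K → Fin 3 → ℝ) (ux uy : Fin 3 → ℝ) (sx sy : ℝ)
    (T : Finset (Fin K × Fin K × Fin K)) (k : Fin K) : ℂ :=
  let z := zVertex v ux uy sx sy
  ∑ t ∈ T, flux ux uy (v t.1) (v t.2.1) (v t.2.2) *
    ((if t.1 = k then 1 / ((z k - z t.2.1) * (z k - z t.2.2)) else 0) +
     (if t.2.1 = k then 1 / ((z k - z t.1) * (z k - z t.2.2)) else 0) +
     (if t.2.2 = k then 1 / ((z k - z t.1) * (z k - z t.2.1)) else 0))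

end ParallelBeam

end

/-!
Since `I(x, y)` integrates the indicator function of the body along the beam, Fubini's theorem
(`integrable_beam_mul`) turns the integral over the window into the integral over the body of
`h'''(ζ r)`, where `ζ r` is the projection of `r` as a complex number.

Let `T` be a triangulation of the boundary and `o` an interior point. The tetrahedra with apex `o`
over the triangles of `T` decompose the body (`IsBoundaryTriangulation.setIntegral_body`), and
over a tetrahedron the integral of `h'''(ζ r)` is six times the volume times the divided difference
of `h` at the four projected vertices, by the Hermite-Genocchi formula
(`integral_corner_eq_dividedDifference`). Hence the integral over the body is a combination of the
values of `h` at the `z k` and at `ζ o`, with weights which are explicit in `o`.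

The integral does not depend on `o`, and evaluations at distinct points are linearly independent on
polynomials (`eq_zero_of_forall_polynomial`). Comparing two apices, the weight at `ζ o` vanishes and
the weights `ρ k` at the `z k` do not depend on `o`. On the other hand, `ρ k * (z k - ζ o)` is the
sum of `n · (v k - o)` times `1 / ((z k - z l) * (z k - z m))` over the triangles at `v k`
(`coneWeight_mul`). Both sides are affine in `o`, so their linear parts agree: `ρ k` is the sum with
`n · ux` in place of `n · (v k - o)`, and `i ρ k` the one with `n · uy`. The mean of the two
resulting expressions for `ρ k` is the stated coefficient. By linear independence once more, it is
the same for all triangulations.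

A triangulation exists (`exists_isBoundaryTriangulation`): move the vertices slightly along the rays
from an interior point, to heights for which no four of them span a common facet plane. The
triangular facets of the resulting polytope are found by the Hahn-Banach theorem and Carathéodory's
theorem (`exists_supporting_triple`), and the same triples of indices serve for the given body.
-/

noncomputable section

namespace ParallelBeam

open MeasureTheory

/-! ### Triple products and cones over facets -/

/-- The oriented volume `a · (b × c)` of the parallelepiped spanned by `a`, `b`, `c`. -/
def triple (a b c : Fin 3 → ℝ) : ℝ := a ⬝ᵥ (b ⨯₃ c)

lemma triple_eq (a b c : Fin 3 → ℝ) : triple a b c =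
    a 0 * (b 1 * c 2 - b 2 * c 1) + a 1 * (b 2 * c 0 - b 0 * c 2)
      + a 2 * (b 0 * c 1 - b 1 * c 0) := by
  simp [triple, crossProduct, dotProduct, Fin.sum_univ_three]

lemma triple_rotate (a b c : Fin 3 → ℝ) : triple b c a = triple a b c := by
  simp only [triple_eq]; ring

lemma triple_swap (a b c : Fin 3 → ℝ) : triple a c b = -triple a b c := by
  simp only [triple_eq]; ring

lemma continuous_triple {X : Type*} [TopologicalSpace X] {f g h : X → Fin 3 → ℝ}
    (hf : Continuous f) (hg : Continuous g) (hh : Continuous h) :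
    Continuous fun x => triple (f x) (g x) (h x) := by
  simp only [triple_eq]; fun_prop

/-- Cramer's rule. -/
lemma triple_smul_eq (a b c x : Fin 3 → ℝ) :
    triple a b c • x = triple x b c • a + triple a x c • b + triple a b x • c := by
  ext i
  fin_cases i <;> simp [triple_eq] <;> ring

lemma triple_ne_zero {z : Fin 3 → Fin 3 → ℝ} (hz : LinearIndependent ℝ z) :
    triple (z 0) (z 1) (z 2) ≠ 0 := by
  have h := (Matrix.linearIndependent_rows_iff_isUnit (A := Matrix.of z)).1 hz
  have h2 := ((Matrix.isUnit_iff_isUnit_det _).1 h).ne_zero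
  rw [Matrix.det_fin_three] at h2
  intro h3
  apply h2
  rw [triple_eq] at h3
  simp only [Matrix.of_apply]
  linarith

lemma triNormal_dotProduct (a b c o : Fin 3 → ℝ) :
    triNormal a b c ⬝ᵥ (a - o) = triple (a - o) (b - o) (c - o) := by
  simp [triple_eq, triNormal, crossProduct, dotProduct, Fin.sum_univ_three]; ring

/-- In a convex polytope around the origin, a ray which avoids the planes spanned by the origin and
two of the given points passes through the interior of a triangle of given points which lies in
a supporting plane `f = 1`. -/
theorem exists_supporting_triple {ι : Type*} [Finite ι] (q : ι → Fin 3 → ℝ)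
    (h0 : 0 ∈ interior (convexHull ℝ (Set.range q))) (w : Fin 3 → ℝ)
    (hw : ∀ a b, w ∉ Submodule.span ℝ {q a, q b}) :
    ∃ i j k, ∃ f : (Fin 3 → ℝ) →ₗ[ℝ] ℝ, f (q i) = 1 ∧ f (q j) = 1 ∧ f (q k) = 1 ∧
      (∀ l, f (q l) ≤ 1) ∧ triple (q i) (q j) (q k) ≠ 0 ∧
      ∃ α β γ : ℝ, 0 < α ∧ 0 < β ∧ 0 < γ ∧ w = α • q i + β • q j + γ • q k := by
  set Q := convexHull ℝ (Set.range q) with hQ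
  have hQconv : Convex ℝ Q := convex_convexHull ℝ _
  have hQclosed : IsClosed Q := (Set.finite_range q).isClosed_convexHull ℝ
  have hQbdd : Bornology.IsBounded Q := isBounded_convexHull.2 (Set.finite_range q).isBounded
  have hQ0 : Q ∈ nhds (0 : Fin 3 → ℝ) := mem_interior_iff_mem_nhds.1 h0
  have hne : Nonempty ι := by
    by_contra h
    rw [not_nonempty_iff] at h
    have : (0 : Fin 3 → ℝ) ∈ Q := interior_subset h0
    simp [hQ, Set.range_eq_empty] at this
  have hw0 : w ≠ 0 := by
    rintro rfl
    exact hw hne.some hne.some (zero_mem _)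
  have hg : 0 < gauge Q w := by
    rw [gauge_pos (absorbent_nhds_zero hQ0) (NormedSpace.isVonNBounded_iff ℝ |>.2 hQbdd)]
    exact hw0
  -- the boundary point of `Q` on the ray through `w`, and a plane supporting `Q` there
  set x : Fin 3 → ℝ := (gauge Q w)⁻¹ • w with hx
  have hgx : gauge Q x = 1 := by
    rw [hx, gauge_smul_of_nonneg (by positivity), smul_eq_mul, inv_mul_cancel₀ hg.ne']
  have hxf : x ∈ frontier Q := (gauge_eq_one_iff_mem_frontier hQconv hQ0).1 hgx
  obtain ⟨f, hf⟩ := geometric_hahn_banach_open_point hQconv.interior isOpen_interior hxf.2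
  have hfx : 0 < f x := by simpa using hf 0 h0
  have hfQ : ∀ a ∈ Q, f a ≤ f x := by
    intro a ha
    have : a ∈ closure (interior Q) := by
      rw [hQconv.closure_interior_eq_closure_of_nonempty_interior ⟨0, h0⟩]
      exact subset_closure ha
    exact closure_minimal (t := {a | f a ≤ f x}) (fun b hb => (hf b hb).le)
      (isClosed_le f.continuous continuous_const) this
  set F : (Fin 3 → ℝ) →ₗ[ℝ] ℝ := (f x)⁻¹ • f.toLinearMap with hF
  have hF1 : ∀ a, F a = (f x)⁻¹ * f a := fun a => rfl
  have hFQ : ∀ a ∈ Q, F a ≤ 1 := by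
    intro a ha
    rw [hF1, inv_mul_le_iff₀ hfx, mul_one]
    exact hfQ a ha
  have hFx : F x = 1 := by rw [hF1, inv_mul_cancel₀ hfx.ne']
  have hxQ : x ∈ Q := hQclosed.frontier_subset hxf
  -- by Carathéodory, `x` is a convex combination of affinely independent given points; they lie in
  -- the supporting plane, which misses the origin, hence they are linearly independent
  obtain ⟨κ, _, z, μ, hz, hzi, hμ, hμ1, hμx⟩ := eq_pos_convex_span_of_mem_convexHull hxQ
  have hzQ : ∀ i, z i ∈ Q := fun i => subset_convexHull ℝ _ (hz ⟨i, rfl⟩)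
  have hFz : ∀ i, F (z i) = 1 := by
    have hs : ∑ i, μ i * (1 - F (z i)) = 0 := by
      have : ∑ i, μ i * F (z i) = 1 := by
        rw [← hFx, ← hμx, map_sum]; simp
      simp only [mul_sub, mul_one, Finset.sum_sub_distrib, hμ1, this, sub_self]
    intro i
    have := (Finset.sum_eq_zero_iff_of_nonneg (fun i _ =>
      mul_nonneg (hμ i).le (sub_nonneg.2 (hFQ _ (hzQ i))))).1 hs i (Finset.mem_univ i)
    rcases mul_eq_zero.1 this with h | h
    · exact absurd h (hμ i).ne'
    · linarith
  have hlin : LinearIndependent ℝ z := by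
    rw [Fintype.linearIndependent_iff]
    intro g hg i
    have hsum : ∑ i, g i = 0 := by
      have := congrArg F hg
      simpa [map_sum, hFz] using this
    refine (affineIndependent_iff.1 hzi) Finset.univ g hsum ?_ i (Finset.mem_univ i)
    exact hg
  choose p hp using fun i => hz ⟨i, rfl⟩
  have hwx : w = gauge Q w • x := by
    rw [hx, smul_smul, mul_inv_cancel₀ hg.ne', one_smul]
  have hcard : Fintype.card κ ≤ 3 := by
    simpa using hlin.fintype_card_le_finrank
  -- fewer than three would put `w` in a plane spanned by two given points
  have hcard3 : Fintype.card κ = 3 := by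
    by_contra hc
    have hc2 : Fintype.card κ = 0 ∨ Fintype.card κ = 1 ∨ Fintype.card κ = 2 := by omega
    rcases hc2 with h | h | h
    · have := Fintype.card_eq_zero_iff.1 h
      simp at hμ1
    · let e := Fintype.equivFinOfCardEq h
      apply hw (p (e.symm 0)) (p (e.symm 0))
      rw [hwx, ← hμx, ← e.symm.sum_comp]
      simp only [Finset.univ_unique, Finset.sum_singleton, hp]
      exact Submodule.smul_mem _ _ (Submodule.smul_mem _ _ (Submodule.subset_span (by simp)))
    · let e := Fintype.equivFinOfCardEq h
      apply hw (p (e.symm 0)) (p (e.symm 1))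
      rw [hwx, ← hμx, ← e.symm.sum_comp]
      simp only [Fin.sum_univ_two, hp]
      exact Submodule.smul_mem _ _ (add_mem
        (Submodule.smul_mem _ _ (Submodule.subset_span (by simp)))
        (Submodule.smul_mem _ _ (Submodule.subset_span (by simp))))
  let e := Fintype.equivFinOfCardEq hcard3
  refine ⟨p (e.symm 0), p (e.symm 1), p (e.symm 2), F, ?_, ?_, ?_, ?_, ?_,
    gauge Q w * μ (e.symm 0), gauge Q w * μ (e.symm 1), gauge Q w * μ (e.symm 2),
    mul_pos hg (hμ _), mul_pos hg (hμ _), mul_pos hg (hμ _), ?_⟩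
  · rw [hp, hFz]
  · rw [hp, hFz]
  · rw [hp, hFz]
  · exact fun l => hFQ _ (subset_convexHull ℝ _ ⟨l, rfl⟩)
  · simp only [hp]
    exact triple_ne_zero (z := z ∘ e.symm) (hlin.comp _ e.symm.injective)
  · conv_lhs => rw [hwx, ← hμx, ← e.symm.sum_comp]
    simp only [Fin.sum_univ_three, hp, smul_add, smul_smul]

/-- The triangle `w i`, `w j`, `w k` is positively oriented as seen from the origin, and the points
`w l / c l` lie below the plane through those with `l = i, j, k`. -/
def IsFacet {ι : Type*} (w : ι → Fin 3 → ℝ) (c : ι → ℝ) (i j k : ι) : Prop :=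
  0 < triple (w i) (w j) (w k) ∧ ∃ f : (Fin 3 → ℝ) →ₗ[ℝ] ℝ,
    f (w i) = c i ∧ f (w j) = c j ∧ f (w k) = c k ∧ ∀ l, f (w l) ≤ c l

lemma IsFacet.rotate {ι : Type*} {w : ι → Fin 3 → ℝ} {c : ι → ℝ} {i j k : ι}
    (h : IsFacet w c i j k) : IsFacet w c j k i := by
  obtain ⟨h, f, h1, h2, h3, h4⟩ := h
  exact ⟨by rwa [triple_rotate], f, h2, h3, h1, h4⟩

open scoped Pointwise in
/-- The cones over the facets cover the space: those over a ray in general position by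
`exists_supporting_triple` for the points `w i / c i`, all others since the union of the cones is
closed. -/
theorem exists_isFacet_cone {ι : Type*} [Finite ι] (w : ι → Fin 3 → ℝ)
    (h0 : 0 ∈ interior (convexHull ℝ (Set.range w))) (c : ι → ℝ) (hc : ∀ i, 0 < c i)
    (hc2 : ∀ i, c i ≤ 2) (x : Fin 3 → ℝ) :
    ∃ i j k, IsFacet w c i j k ∧ ∃ α β γ : ℝ, 0 ≤ α ∧ 0 ≤ β ∧ 0 ≤ γ ∧
      x = α • w i + β • w j + γ • w k := by
  have := Fintype.ofFinite ι
  set q : ι → Fin 3 → ℝ := fun i => (c i)⁻¹ • w i with hq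
  have hwq : ∀ i, w i = c i • q i := fun i => by
    rw [hq]; simp only [smul_smul, mul_inv_cancel₀ (hc i).ne', one_smul]
  have hconv : Convex ℝ (convexHull ℝ (Set.range q)) := convex_convexHull ℝ _
  have h0q : (0 : Fin 3 → ℝ) ∈ convexHull ℝ (Set.range q) := by
    have h1 := interior_subset h0
    rw [convexHull_range_eq_exists_affineCombination] at h1
    obtain ⟨s, μ, hμ0, hμ1, hμ⟩ := h1
    rw [Finset.affineCombination_eq_linear_combination _ _ _ hμ1] at hμ
    have hpos : 0 < ∑ i ∈ s, μ i * c i := by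
      obtain ⟨i, hi, hi'⟩ : ∃ i ∈ s, 0 < μ i := by
        by_contra! h
        have := Finset.sum_nonpos h
        linarith
      exact Finset.sum_pos' (fun i hi => mul_nonneg (hμ0 i hi) (hc i).le)
        ⟨i, hi, mul_pos hi' (hc i)⟩
    have := hconv.sum_mem (t := s) (w := fun i => (∑ i ∈ s, μ i * c i)⁻¹ * (μ i * c i))
      (z := q) (fun i hi => mul_nonneg (inv_nonneg.2 hpos.le) (mul_nonneg (hμ0 i hi) (hc i).le))
      (by rw [← Finset.mul_sum, inv_mul_cancel₀ hpos.ne'])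
      (fun i _ => subset_convexHull ℝ _ ⟨i, rfl⟩)
    convert this using 1
    simp only [mul_smul, ← Finset.smul_sum, ← hwq, hμ, smul_zero]
  -- `Q = conv (w i / c i)` is a neighbourhood of the origin, as it contains `conv (w i) / 2`
  have h0Q : (0 : Fin 3 → ℝ) ∈ interior (convexHull ℝ (Set.range q)) := by
    have hsub : (2⁻¹ : ℝ) • convexHull ℝ (Set.range w) ⊆ convexHull ℝ (Set.range q) := by
      rw [← convexHull_smul]
      refine convexHull_min ?_ hconv
      rintro _ ⟨_, ⟨i, rfl⟩, rfl⟩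
      have := hconv.smul_mem_of_zero_mem h0q (subset_convexHull ℝ _ ⟨i, rfl⟩)
        (t := 2⁻¹ * c i) ⟨by have := hc i; positivity, by have := hc2 i; linarith⟩
      simpa [hwq i, smul_smul] using this
    refine interior_mono hsub ?_
    rw [interior_smul₀ (by norm_num)]
    exact ⟨0, h0, smul_zero _⟩
  -- the union of the cones, written by Cramer's rule through closed conditions
  let C : Set (Fin 3 → ℝ) := {x | ∃ i j k, IsFacet w c i j k ∧ 0 ≤ triple x (w j) (w k) ∧
    0 ≤ triple (w i) x (w k) ∧ 0 ≤ triple (w i) (w j) x}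
  have hC : IsClosed C := by
    simp only [C, Set.ofPred_exists]
    refine isClosed_iUnion_of_finite fun i => isClosed_iUnion_of_finite fun j =>
      isClosed_iUnion_of_finite fun k => ?_
    refine isClosed_const.and ((isClosed_le continuous_const ?_).and
      ((isClosed_le continuous_const ?_).and (isClosed_le continuous_const ?_)))
    all_goals exact continuous_triple (by fun_prop) (by fun_prop) (by fun_prop)
  have hdense : Dense {x : Fin 3 → ℝ | ∀ a b, x ∉ Submodule.span ℝ {q a, q b}} := by
    refine MeasureTheory.Measure.dense_of_ae (μ := MeasureTheory.volume) ?_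
    rw [MeasureTheory.ae_all_iff]
    intro a
    rw [MeasureTheory.ae_all_iff]
    intro b
    rw [MeasureTheory.ae_iff]
    simp only [not_not]
    refine MeasureTheory.Measure.addHaar_submodule MeasureTheory.volume
      (Submodule.span ℝ {q a, q b}) fun h => ?_
    have h1 := finrank_span_finset_le_card (R := ℝ) ({q a, q b} : Finset (Fin 3 → ℝ))
    have h2 : ({q a, q b} : Finset (Fin 3 → ℝ)).card ≤ 2 := Finset.card_le_two
    rw [Set.finrank] at h1
    rw [Finset.coe_pair, h, finrank_top] at h1
    have h3 : Module.finrank ℝ (Fin 3 → ℝ) = 3 := Module.finrank_fin_fun ℝ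
    omega
  have hxC : x ∈ C := by
    refine hC.closure_subset_iff.2 ?_ (hdense x)
    intro x hx
    -- exchanging the last two points if necessary, the triple is positively oriented
    obtain ⟨i, j, k, f, hi, hj, hk, hl, hpos, α, β, γ, hα, hβ, hγ, rfl⟩ :
        ∃ i j k, ∃ f : (Fin 3 → ℝ) →ₗ[ℝ] ℝ, f (q i) = 1 ∧ f (q j) = 1 ∧ f (q k) = 1 ∧
          (∀ l, f (q l) ≤ 1) ∧ 0 < triple (q i) (q j) (q k) ∧
          ∃ α β γ : ℝ, 0 < α ∧ 0 < β ∧ 0 < γ ∧ x = α • q i + β • q j + γ • q k := by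
      obtain ⟨i, j, k, f, hi, hj, hk, hl, hD, α, β, γ, hα, hβ, hγ, hx⟩ :=
        exists_supporting_triple q h0Q x hx
      rcases lt_or_gt_of_ne hD with hneg | hpos
      · exact ⟨i, k, j, f, hi, hk, hj, hl, by rw [triple_swap]; linarith,
          α, γ, β, hα, hγ, hβ, by rw [hx]; abel⟩
      · exact ⟨i, j, k, f, hi, hj, hk, hl, hpos, α, β, γ, hα, hβ, hγ, hx⟩
    have hfw : ∀ l, f (w l) = c l * f (q l) := fun l => by rw [hwq l]; simp
    have hfl : ∀ l, f (w l) ≤ c l := fun l => by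
      rw [hfw]; nlinarith [hl l, hc l]
    have hci := hc i
    have hcj := hc j
    have hck := hc k
    have hDw : triple (w i) (w j) (w k) = c i * c j * c k * triple (q i) (q j) (q k) := by
      simp only [hwq i, hwq j, hwq k, triple_eq, Pi.smul_apply, smul_eq_mul]; ring
    refine ⟨i, j, k, ⟨?_, f, ?_, ?_, ?_, hfl⟩, ?_, ?_, ?_⟩
    · rw [hDw]
      positivity
    · rw [hfw, hi, mul_one]
    · rw [hfw, hj, mul_one]
    · rw [hfw, hk, mul_one]
    · have : triple (α • q i + β • q j + γ • q k) (w j) (w k) =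
          α * c j * c k * triple (q i) (q j) (q k) := by
        simp only [hwq j, hwq k, triple_eq, Pi.smul_apply, Pi.add_apply, smul_eq_mul]; ring
      rw [this]
      positivity
    · have : triple (w i) (α • q i + β • q j + γ • q k) (w k) =
          β * c i * c k * triple (q i) (q j) (q k) := by
        simp only [hwq k, hwq i, triple_eq, Pi.smul_apply, Pi.add_apply, smul_eq_mul]; ring
      rw [this]
      positivity
    · have : triple (w i) (w j) (α • q i + β • q j + γ • q k) =
          γ * c i * c j * triple (q i) (q j) (q k) := by
        simp only [hwq j, hwq i, triple_eq, Pi.smul_apply, Pi.add_apply, smul_eq_mul]; ring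
      rw [this]
      positivity
  obtain ⟨i, j, k, hF, h1, h2, h3⟩ := hxC
  refine ⟨i, j, k, hF, (triple (w i) (w j) (w k))⁻¹ * triple x (w j) (w k),
    (triple (w i) (w j) (w k))⁻¹ * triple (w i) x (w k),
    (triple (w i) (w j) (w k))⁻¹ * triple (w i) (w j) x,
    mul_nonneg (inv_nonneg.2 hF.1.le) h1, mul_nonneg (inv_nonneg.2 hF.1.le) h2,
    mul_nonneg (inv_nonneg.2 hF.1.le) h3, ?_⟩
  rw [mul_smul, mul_smul, mul_smul, ← smul_add, ← smul_add, ← triple_smul_eq, smul_smul,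
    inv_mul_cancel₀ hF.1.ne', one_smul]

/-! ### Triangulating the boundary -/

lemma triple_self_right (a b : Fin 3 → ℝ) : triple a b b = 0 := by
  simp only [triple_eq]; ring

/-- The height of `w l / c l` below the plane through `w i / c i`, `w j / c j`, `w k / c k`, as seen
from the origin, up to a factor which is positive if `i`, `j`, `k` are positively oriented. -/
def gap {ι : Type*} (w : ι → Fin 3 → ℝ) (c : ι → ℝ) (i j k l : ι) : ℝ :=
  triple (w i) (w j) (w k) * c l - (triple (w l) (w j) (w k) * c i +
    triple (w i) (w l) (w k) * c j + triple (w i) (w j) (w l) * c k)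

lemma gap_eq {ι : Type*} {w : ι → Fin 3 → ℝ} {c : ι → ℝ} {i j k : ι}
    {f : (Fin 3 → ℝ) →ₗ[ℝ] ℝ} (hi : f (w i) = c i) (hj : f (w j) = c j) (hk : f (w k) = c k)
    (l : ι) : gap w c i j k l = triple (w i) (w j) (w k) * (c l - f (w l)) := by
  have h := congrArg f (triple_smul_eq (w i) (w j) (w k) (w l))
  simp only [map_add, map_smul, smul_eq_mul, hi, hj, hk] at h
  rw [gap, mul_sub, h]

/-- Heights close to `1` for which every facet is a triangle and lies over a face of the polytope
with the heights `1`. -/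
theorem exists_generic_heights {K : ℕ} (w : Fin K → Fin 3 → ℝ) :
    ∃ c : Fin K → ℝ, (∀ i, 0 < c i) ∧ (∀ i, c i ≤ 2) ∧
      (∀ i j k l, gap w 1 i j k l < 0 → gap w c i j k l < 0) ∧
      ∀ i j k l, 0 < triple (w i) (w j) (w k) → gap w c i j k l = 0 → l = i ∨ l = j ∨ l = k := by
  -- each `gap` is a polynomial in `s`, and its value at `s = 0` is the one for the heights `1`
  let c : ℝ → Fin K → ℝ := fun s i => 1 + s ^ (i.1 + 1)
  have hgap : ∀ i j k l, Continuous fun s => gap w (c s) i j k l := by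
    intro i j k l
    simp only [gap, c]
    fun_prop
  have h1 : ∀ᶠ s in nhdsWithin (0 : ℝ) (Set.Ioi 0), ∀ i j k l,
      gap w 1 i j k l < 0 → gap w (c s) i j k l < 0 := by
    simp only [Filter.eventually_all]
    intro i j k l hneg
    refine nhdsWithin_le_nhds ?_
    refine (hgap i j k l).continuousAt.eventually_lt continuousAt_const ?_
    have : c 0 = 1 := by ext i; simp [c]
    rwa [this]
  have h2 : ∀ᶠ s in nhdsWithin (0 : ℝ) (Set.Ioi 0), ∀ i j k l,
      0 < triple (w i) (w j) (w k) → gap w (c s) i j k l = 0 → l = i ∨ l = j ∨ l = k := by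
    simp only [Filter.eventually_all]
    intro i j k l hpos
    by_cases hl : l = i ∨ l = j ∨ l = k
    · exact Filter.Eventually.of_forall fun s _ => hl
    simp only [not_or] at hl
    let P : Polynomial ℝ :=
      Polynomial.C (triple (w i) (w j) (w k)) * (1 + Polynomial.X ^ (l.1 + 1)) -
      (Polynomial.C (triple (w l) (w j) (w k)) * (1 + Polynomial.X ^ (i.1 + 1)) +
        Polynomial.C (triple (w i) (w l) (w k)) * (1 + Polynomial.X ^ (j.1 + 1)) +
        Polynomial.C (triple (w i) (w j) (w l)) * (1 + Polynomial.X ^ (k.1 + 1)))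
    have hPe : ∀ s, P.eval s = gap w (c s) i j k l := by
      intro s
      simp [P, gap, c]
    -- as `l ≠ i, j, k`, the power `l + 1` occurs in the first summand only
    have hP0 : P ≠ 0 := by
      intro h
      have hco := congrArg (fun p => Polynomial.coeff p (l.1 + 1)) h
      have hli : ¬ (l.1 = i.1) := fun h => hl.1 (Fin.ext h)
      have hlj : ¬ (l.1 = j.1) := fun h => hl.2.1 (Fin.ext h)
      have hlk : ¬ (l.1 = k.1) := fun h => hl.2.2 (Fin.ext h)
      simp [P, Polynomial.coeff_X_pow, Polynomial.coeff_one, hli, hlj, hlk] at hco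
      exact hpos.ne' hco
    have hfin : ({s | P.IsRoot s} \ {0}).Finite := (Polynomial.finite_setOfPred_isRoot hP0).subset
      Set.sdiff_subset
    have : ∀ᶠ s in nhdsWithin (0 : ℝ) (Set.Ioi 0), s ∈ ({s | P.IsRoot s} \ {0})ᶜ :=
      nhdsWithin_le_nhds (hfin.isClosed.isOpen_compl.mem_nhds (by simp))
    filter_upwards [this, self_mem_nhdsWithin] with s hs hs0 hg
    exact absurd ⟨(hPe s).trans hg, (Set.mem_Ioi.1 hs0).ne'⟩ hs
  have h3 : ∀ᶠ s in nhdsWithin (0 : ℝ) (Set.Ioi 0), s ∈ Set.Ioo (0 : ℝ) 1 :=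
    Ioo_mem_nhdsGT one_pos
  obtain ⟨s, hs1, hs2, hs3⟩ := (h1.and (h2.and h3)).exists
  refine ⟨c s, fun i => ?_, fun i => ?_, hs1, hs2⟩
  · have := pow_pos hs3.1 (i.1 + 1)
    simp only [c]; linarith
  · have := pow_le_one₀ (n := i.1 + 1) hs3.1.le hs3.2.le
    simp only [c]; linarith

lemma convex_body {K : ℕ} (v : Fin K → Fin 3 → ℝ) : Convex ℝ (body v) := convex_convexHull ℝ _

lemma isCompact_body {K : ℕ} (v : Fin K → Fin 3 → ℝ) : IsCompact (body v) :=
  (Set.finite_range v).isCompact_convexHull ℝ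

lemma vertex_mem_body {K : ℕ} (v : Fin K → Fin 3 → ℝ) (k : Fin K) : v k ∈ body v :=
  subset_convexHull ℝ _ ⟨k, rfl⟩

lemma interior_body_nonempty {K : ℕ} {v : Fin K → Fin 3 → ℝ}
    (h : affineSpan ℝ (Set.range v) = ⊤) : (interior (body v)).Nonempty :=
  interior_convexHull_nonempty_iff_affineSpan_eq_top.2 h

lemma dotProduct_sub_nonpos_of_mem_body {K : ℕ} {v : Fin K → Fin 3 → ℝ} {n a : Fin 3 → ℝ}
    (h : ∀ i, n ⬝ᵥ (v i - a) ≤ 0) {r : Fin 3 → ℝ} (hr : r ∈ body v) : n ⬝ᵥ (r - a) ≤ 0 := by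
  have hlin : IsLinearMap ℝ fun r : Fin 3 → ℝ => n ⬝ᵥ r :=
    ⟨fun x y => dotProduct_add n x y, fun c x => by simp [dotProduct_smul]⟩
  have : body v ⊆ {r | n ⬝ᵥ r ≤ n ⬝ᵥ a} := by
    refine convexHull_min ?_ (convex_halfSpace_le hlin _)
    rintro _ ⟨i, rfl⟩
    have := h i
    rw [dotProduct_sub] at this
    simpa using this
  have h2 := this hr
  rw [dotProduct_sub]
  simpa using h2

/-- A supporting plane of the body does not meet its interior. -/
lemma dotProduct_sub_neg_of_mem_interior {K : ℕ} {v : Fin K → Fin 3 → ℝ} {n a : Fin 3 → ℝ}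
    (hn : n ≠ 0) (h : ∀ i, n ⬝ᵥ (v i - a) ≤ 0) {r : Fin 3 → ℝ} (hr : r ∈ interior (body v)) :
    n ⬝ᵥ (r - a) < 0 := by
  -- from an interior point, one can move a little in the direction of the normal
  have hc : Continuous fun s : ℝ => r + s • n := by fun_prop
  have h1 : ∀ᶠ s in nhdsWithin (0 : ℝ) (Set.Ioi 0), r + s • n ∈ body v := by
    refine nhdsWithin_le_nhds (hc.continuousAt.preimage_mem_nhds ?_)
    simpa using mem_interior_iff_mem_nhds.1 hr
  obtain ⟨s, hs, hs0⟩ := (h1.and self_mem_nhdsWithin).exists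
  have h2 := dotProduct_sub_nonpos_of_mem_body h hs
  have h3 : 0 < n ⬝ᵥ n := by
    have := dotProduct_self_eq_zero (v := n)
    refine lt_of_le_of_ne ?_ fun h => hn (this.1 h.symm)
    exact Finset.sum_nonneg fun i _ => mul_self_nonneg _
  have h4 : n ⬝ᵥ (r + s • n - a) = n ⬝ᵥ (r - a) + s * (n ⬝ᵥ n) := by
    simp only [dotProduct_sub, dotProduct_add, dotProduct_smul, smul_eq_mul]; ring
  have := mul_pos (Set.mem_Ioi.1 hs0) h3
  linarith

lemma zero_mem_interior_convexHull_sub {K : ℕ} {v : Fin K → Fin 3 → ℝ} {o : Fin 3 → ℝ}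
    (ho : o ∈ interior (body v)) :
    0 ∈ interior (convexHull ℝ (Set.range fun k => v k - o)) := by
  rw [mem_interior_iff_mem_nhds] at ho ⊢
  have hsub : body v ⊆ (fun x => -o + x) ⁻¹' convexHull ℝ (Set.range fun k => v k - o) := by
    refine convexHull_min ?_ ((convex_convexHull ℝ _).translate_preimage_right (-o))
    rintro _ ⟨i, rfl⟩
    exact subset_convexHull ℝ _ ⟨i, by simp only; abel⟩
  have hc : Continuous fun x : Fin 3 → ℝ => x + o := by fun_prop
  have : (fun x : Fin 3 → ℝ => x + o) ⁻¹' body v ∈ nhds 0 :=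
    hc.continuousAt.preimage_mem_nhds (by simpa using ho)
  refine Filter.mem_of_superset this fun x hx => ?_
  simpa using hsub hx

lemma mem_convexHull_triple {a b c : Fin 3 → ℝ} {α β γ : ℝ} (hα : 0 ≤ α) (hβ : 0 ≤ β)
    (hγ : 0 ≤ γ) (h : α + β + γ = 1) :
    α • a + β • b + γ • c ∈ convexHull ℝ {a, b, c} := by
  have hc := convex_convexHull ℝ ({a, b, c} : Set (Fin 3 → ℝ))
  have := hc.sum_mem (t := Finset.univ) (w := ![α, β, γ]) (z := ![a, b, c])
    (by intro i _; fin_cases i <;> simpa) (by simp [Fin.sum_univ_three, h])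
    (by intro i _; refine subset_convexHull ℝ _ ?_; fin_cases i <;> simp)
  simpa [Fin.sum_univ_three] using this

/-- The points of a triangle in a supporting plane are boundary points. -/
lemma convexHull_triple_subset_frontier {K : ℕ} {v : Fin K → Fin 3 → ℝ} {i j k : Fin K}
    (hn : triNormal (v i) (v j) (v k) ≠ 0)
    (hout : ∀ l, triNormal (v i) (v j) (v k) ⬝ᵥ (v l - v i) ≤ 0) :
    convexHull ℝ {v i, v j, v k} ⊆ frontier (body v) := by
  intro x hx
  have hxb : x ∈ body v := convexHull_mono (by
    rintro _ (rfl | rfl | rfl) <;> exact ⟨_, rfl⟩) hx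
  refine ⟨subset_closure hxb, fun hxi => ?_⟩
  have h1 := dotProduct_sub_neg_of_mem_interior hn hout hxi
  have hlin : IsLinearMap ℝ fun r : Fin 3 → ℝ => triNormal (v i) (v j) (v k) ⬝ᵥ r :=
    ⟨fun x y => dotProduct_add _ x y, fun c x => by simp [dotProduct_smul]⟩
  have h2 : convexHull ℝ {v i, v j, v k} ⊆
      {r | triNormal (v i) (v j) (v k) ⬝ᵥ v i ≤ triNormal (v i) (v j) (v k) ⬝ᵥ r} := by
    refine convexHull_min ?_ (convex_halfSpace_ge hlin _)
    rintro _ (rfl | rfl | rfl)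
    · exact Set.mem_ofPred_eq ▸ le_rfl
    · rw [Set.mem_ofPred_eq]; refine le_of_eq ?_
      simp [triNormal, crossProduct, dotProduct, Fin.sum_univ_three]; ring
    · rw [Set.mem_ofPred_eq]; refine le_of_eq ?_
      simp [triNormal, crossProduct, dotProduct, Fin.sum_univ_three]; ring
  have h3 : triNormal (v i) (v j) (v k) ⬝ᵥ v i ≤ triNormal (v i) (v j) (v k) ⬝ᵥ x := h2 hx
  rw [dotProduct_sub] at h1
  linarith

/-- The boundary of a solid polyhedron has a triangulation. Seen from an interior point `o`, the
points `o + (v k - o) / c k` with generic heights `c k` near `1` span a polytope with triangular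
facets only; the same triples of indices triangulate the original boundary. Each facet is listed
with its least index first. -/
theorem exists_isBoundaryTriangulation {K : ℕ} {v : Fin K → Fin 3 → ℝ}
    (hv : affineSpan ℝ (Set.range v) = ⊤) : ∃ T, IsBoundaryTriangulation v T := by
  classical
  obtain ⟨o, ho⟩ := interior_body_nonempty hv
  set w : Fin K → Fin 3 → ℝ := fun k => v k - o with hw
  have h0 := zero_mem_interior_convexHull_sub ho
  obtain ⟨c, hc0, hc2, hc1, hcg⟩ := exists_generic_heights w
  let T : Finset (Fin K × Fin K × Fin K) :=
    {t | t.1 < t.2.1 ∧ t.1 < t.2.2 ∧ IsFacet w c t.1 t.2.1 t.2.2}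
  have hT : ∀ t, t ∈ T ↔ t.1 < t.2.1 ∧ t.1 < t.2.2 ∧ IsFacet w c t.1 t.2.1 t.2.2 := by
    intro t; simp [T]
  have hnon : ∀ i j k, IsFacet w c i j k → triNormal (v i) (v j) (v k) ≠ 0 := by
    intro i j k h h'
    have := h.1
    rw [hw, ← triNormal_dotProduct, h', zero_dotProduct] at this
    exact lt_irrefl _ this
  have hout : ∀ i j k, IsFacet w c i j k →
      ∀ l, triNormal (v i) (v j) (v k) ⬝ᵥ (v l - v i) ≤ 0 := by
    rintro i j k ⟨hD, f, hi, hj, hk, hl⟩ l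
    have h1 : 0 ≤ gap w c i j k l := by
      rw [gap_eq hi hj hk]
      exact mul_nonneg hD.le (sub_nonneg.2 (hl l))
    have h2 : 0 ≤ gap w 1 i j k l := not_lt.1 fun h => absurd (hc1 i j k l h) (not_lt.2 h1)
    have h3 : triNormal (v i) (v j) (v k) ⬝ᵥ (v l - v i) = - gap w 1 i j k l := by
      simp [gap, triple_eq, hw, triNormal, crossProduct, dotProduct, Fin.sum_univ_three]
      ring
    linarith
  refine ⟨T, fun t ht => hnon _ _ _ ((hT t).1 ht).2.2, fun t ht => hout _ _ _ ((hT t).1 ht).2.2,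
    Set.Subset.antisymm ?_ ?_, ?_⟩
  · refine Set.iUnion₂_subset fun t ht => ?_
    have := ((hT t).1 ht).2.2
    exact convexHull_triple_subset_frontier (hnon _ _ _ this) (hout _ _ _ this)
  · intro x hx
    have key : ∀ i j k, IsFacet w c i j k → ∀ α β γ : ℝ, 0 ≤ α → 0 ≤ β → 0 ≤ γ →
        x - o = α • w i + β • w j + γ • w k → x ∈ convexHull ℝ {v i, v j, v k} := by
      intro i j k hF α β γ hα hβ hγ hx'
      have hxb : x ∈ body v := (isCompact_body v).isClosed.frontier_subset hx
      have hx2 : x = o + (α • w i + β • w j + γ • w k) := by rw [← hx']; abel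
      have hsum : α + β + γ ≤ 1 := by
        have h1 := dotProduct_sub_nonpos_of_mem_body (hout _ _ _ hF) hxb
        have h2 : triNormal (v i) (v j) (v k) ⬝ᵥ (x - v i) =
            (α + β + γ - 1) * triple (w i) (w j) (w k) := by
          rw [hx2]
          simp [triple_eq, hw, triNormal, crossProduct, dotProduct, Fin.sum_univ_three]
          ring
        rw [h2] at h1
        by_contra hlt
        exact absurd h1 (not_le.2 (mul_pos (by linarith) hF.1))
      -- with sum less than `1`, `x` is strictly between `o` and a point of the body
      rcases hsum.lt_or_eq with hlt | heq
      · exfalso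
        refine hx.2 ?_
        rcases eq_or_lt_of_le (by positivity : 0 ≤ α + β + γ) with hz | hz
        · have hα0 : α = 0 := by linarith
          have hβ0 : β = 0 := by linarith
          have hγ0 : γ = 0 := by linarith
          rwa [hx2, hα0, hβ0, hγ0, zero_smul, zero_smul, zero_smul, add_zero, add_zero, add_zero]
        · set σ := α + β + γ with hσ
          have hp : (α / σ) • v i + (β / σ) • v j + (γ / σ) • v k ∈ body v := by
            refine convexHull_mono ?_ (mem_convexHull_triple (a := v i) (b := v j) (c := v k)
              (div_nonneg hα hz.le) (div_nonneg hβ hz.le) (div_nonneg hγ hz.le) (by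
              rw [← add_div, ← add_div, ← hσ, div_self hz.ne']))
            rintro _ (rfl | rfl | rfl) <;> exact ⟨_, rfl⟩
          have := (convex_body v).combo_interior_self_mem_interior ho hp
            (a := 1 - σ) (b := σ) (by linarith) hz.le (by ring)
          convert this using 1
          rw [hx2]
          ext m
          simp [hw]
          field_simp
          rw [hσ]; ring
      · have hx3 : x = α • v i + β • v j + γ • v k := by
          rw [hx2]
          have : o = (α + β + γ) • o := by rw [heq, one_smul]
          simp only [hw, smul_sub]
          nth_rw 1 [this]
          simp only [add_smul]; abel
        rw [hx3]
        exact mem_convexHull_triple hα hβ hγ heq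
    obtain ⟨i, j, k, hF, α, β, γ, hα, hβ, hγ, hx'⟩ := exists_isFacet_cone w h0 c hc0 hc2 (x - o)
    have hx1 := key i j k hF α β γ hα hβ hγ hx'
    have hij : i ≠ j := by
      rintro rfl
      have := hF.rotate.rotate.1
      rw [triple_self_right] at this
      exact lt_irrefl _ this
    have hjk : j ≠ k := by
      rintro rfl
      have := hF.1
      rw [triple_self_right] at this
      exact lt_irrefl _ this
    have hik : i ≠ k := by
      rintro rfl
      have := hF.rotate.1
      rw [triple_self_right] at this
      exact lt_irrefl _ this
    simp only [Set.mem_iUnion]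
    rcases lt_or_gt_of_ne hij with h1 | h1
    · rcases lt_or_gt_of_ne hik with h2 | h2
      · exact ⟨(i, j, k), (hT _).2 ⟨h1, h2, hF⟩, hx1⟩
      · refine ⟨(k, i, j), (hT _).2 ⟨h2, h2.trans h1, hF.rotate.rotate⟩, ?_⟩
        exact convexHull_mono (by intro y; simp; tauto) hx1
    · rcases lt_or_gt_of_ne hjk with h2 | h2
      · refine ⟨(j, k, i), (hT _).2 ⟨h2, h1, hF.rotate⟩, ?_⟩
        exact convexHull_mono (by intro y; simp; tauto) hx1
      · refine ⟨(k, i, j), (hT _).2 ⟨h2.trans h1, h2, hF.rotate.rotate⟩, ?_⟩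
        exact convexHull_mono (by intro y; simp; tauto) hx1
  · rintro ⟨i, j, k⟩ ht ⟨i', j', k'⟩ ht' hne
    rw [Set.disjoint_left]
    rintro p ⟨α, β, γ, hα, hβ, hγ, hs, hp⟩ ⟨α', β', γ', hα', hβ', hγ', hs', hp'⟩
    obtain ⟨hij, hik, hD, f, hfi, hfj, hfk, hfl⟩ := (hT _).1 ht
    obtain ⟨hij', hik', hD', f', hfi', hfj', hfk', hfl'⟩ := (hT _).1 ht'
    simp only at *
    apply hne
    have hpw : p - o = α • w i + β • w j + γ • w k := by
      rw [hp]
      have : o = (α + β + γ) • o := by rw [hs, one_smul]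
      nth_rw 1 [this]
      simp only [hw, smul_sub, add_smul]; abel
    have hpw' : p - o = α' • w i' + β' • w j' + γ' • w k' := by
      rw [hp']
      have : o = (α' + β' + γ') • o := by rw [hs', one_smul]
      nth_rw 1 [this]
      simp only [hw, smul_sub, add_smul]; abel
    -- comparing the two supporting functions at a common point, `f` attains the heights also at
    -- the vertices of the second triangle, which are thus those of the first by genericity
    have e1 := congrArg f (hpw.symm.trans hpw')
    have e2 := congrArg f' (hpw.symm.trans hpw')
    simp only [map_add, map_smul, smul_eq_mul, hfi, hfj, hfk, hfi', hfj', hfk'] at e1 e2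
    have a1 := mul_le_mul_of_nonneg_left (hfl i') hα'.le
    have a2 := mul_le_mul_of_nonneg_left (hfl j') hβ'.le
    have a3 := mul_le_mul_of_nonneg_left (hfl k') hγ'.le
    have b1 := mul_le_mul_of_nonneg_left (hfl' i) hα.le
    have b2 := mul_le_mul_of_nonneg_left (hfl' j) hβ.le
    have b3 := mul_le_mul_of_nonneg_left (hfl' k) hγ.le
    have g1 : f (w i') = c i' := mul_left_cancel₀ hα'.ne' (by linarith)
    have g2 : f (w j') = c j' := mul_left_cancel₀ hβ'.ne' (by linarith)
    have g3 : f (w k') = c k' := mul_left_cancel₀ hγ'.ne' (by linarith)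
    have m1 := hcg i j k i' hD (by rw [gap_eq hfi hfj hfk, g1, sub_self, mul_zero])
    have m2 := hcg i j k j' hD (by rw [gap_eq hfi hfj hfk, g2, sub_self, mul_zero])
    have m3 := hcg i j k k' hD (by rw [gap_eq hfi hfj hfk, g3, sub_self, mul_zero])
    have hjk' : j' ≠ k' := by
      rintro rfl
      rw [triple_self_right] at hD'
      exact lt_irrefl _ hD'
    rcases m1 with rfl | rfl | rfl <;> rcases m2 with rfl | rfl | rfl <;>
      rcases m3 with rfl | rfl | rfl <;>
      first
        | rfl
        | (exfalso; omega)
        | (exfalso; rw [triple_swap] at hD'; linarith)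

/-! ### Integration over a tetrahedron: the Hermite-Genocchi formula -/

/-- The affine map which takes the origin and the standard frame to the point `o` and the frame
`a`, `b`, `c`. -/
def frame (o a b c x : Fin 3 → ℝ) : Fin 3 → ℝ := o + x 0 • a + x 1 • b + x 2 • c

lemma continuous_frame (o a b c : Fin 3 → ℝ) : Continuous (frame o a b c) := by
  unfold frame; fun_prop

lemma frame_injective {o a b c : Fin 3 → ℝ} (h : triple a b c ≠ 0) :
    Function.Injective (frame o a b c) := by
  intro x y hxy
  have h0 : (x 0 - y 0) • a + (x 1 - y 1) • b + (x 2 - y 2) • c = 0 := by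
    have := sub_eq_zero.2 hxy
    rw [← this]; simp only [frame, sub_smul]; abel
  have e0 : (x 0 - y 0) * triple a b c = 0 := by
    have : triple ((x 0 - y 0) • a + (x 1 - y 1) • b + (x 2 - y 2) • c) b c
        = (x 0 - y 0) * triple a b c := by simp [triple_eq]; ring
    rw [← this, h0]; simp [triple_eq]
  have e1 : (x 1 - y 1) * triple a b c = 0 := by
    have : triple a ((x 0 - y 0) • a + (x 1 - y 1) • b + (x 2 - y 2) • c) c
        = (x 1 - y 1) * triple a b c := by simp [triple_eq]; ring
    rw [← this, h0]; simp [triple_eq]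
  have e2 : (x 2 - y 2) * triple a b c = 0 := by
    have : triple a b ((x 0 - y 0) • a + (x 1 - y 1) • b + (x 2 - y 2) • c)
        = (x 2 - y 2) * triple a b c := by simp [triple_eq]; ring
    rw [← this, h0]; simp [triple_eq]
  ext i
  fin_cases i
  · exact sub_eq_zero.1 ((mul_eq_zero.1 e0).resolve_right h)
  · exact sub_eq_zero.1 ((mul_eq_zero.1 e1).resolve_right h)
  · exact sub_eq_zero.1 ((mul_eq_zero.1 e2).resolve_right h)

lemma hasFDerivAt_frame (o a b c x : Fin 3 → ℝ) :
    HasFDerivAt (frame o a b c) (LinearMap.toContinuousLinearMap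
      (Matrix.toLin' (Matrix.of ![a, b, c])ᵀ)) x := by
  have : frame o a b c = fun x => o + (LinearMap.toContinuousLinearMap
      (Matrix.toLin' (Matrix.of ![a, b, c])ᵀ)) x := by
    ext x i
    simp [frame, Matrix.mulVec, dotProduct, Fin.sum_univ_three]; ring
  rw [this]
  exact (ContinuousLinearMap.hasFDerivAt _).const_add o

/-- Change of variables to the coordinates of a frame. -/
theorem setIntegral_image_frame {o a b c : Fin 3 → ℝ} (h : triple a b c ≠ 0)
    {s : Set (Fin 3 → ℝ)} (hs : MeasurableSet s) (g : (Fin 3 → ℝ) → ℂ) :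
    ∫ y in frame o a b c '' s, g y = |triple a b c| • ∫ x in s, g (frame o a b c x) := by
  rw [integral_image_eq_integral_abs_det_fderiv_smul volume hs
    (fun x _ => (hasFDerivAt_frame o a b c x).hasFDerivWithinAt) (frame_injective h).injOn]
  have : (LinearMap.toContinuousLinearMap
      (Matrix.toLin' (Matrix.of ![a, b, c])ᵀ)).det = triple a b c := by
    simp only [ContinuousLinearMap.det, LinearMap.coe_toContinuousLinearMap,
      LinearMap.det_toLin', Matrix.det_transpose]
    rw [Matrix.det_fin_three, triple_eq]
    simp; ring
  rw [this, integral_smul]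

/-- A triple of real numbers as a vector. -/
def vec (p : ℝ × ℝ × ℝ) : Fin 3 → ℝ := ![p.1, p.2.1, p.2.2]

lemma exists_measurableEquiv_vec : ∃ e : (ℝ × ℝ × ℝ) ≃ᵐ (Fin 3 → ℝ), (⇑e = vec) ∧
    MeasurePreserving e := by
  let e1 := MeasurableEquiv.piFinSuccAbove (fun _ : Fin 3 => ℝ) 0
  have h1 : MeasurePreserving e1 := volume_preserving_piFinSuccAbove (fun _ : Fin 3 => ℝ) 0
  let e2 := (MeasurableEquiv.refl ℝ).prodCongr (MeasurableEquiv.finTwoArrow (α := ℝ))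
  have h2 : MeasurePreserving e2 :=
    (MeasurePreserving.id volume).prod (volume_preserving_finTwoArrow ℝ)
  refine ⟨(e1.trans e2).symm, ?_, (h2.comp h1).symm (e1.trans e2)⟩
  funext p
  rw [MeasurableEquiv.symm_apply_eq]
  rfl

/-- The corner of the first octant which is cut off by the plane `x + y + z = 1`. -/
def corner : Set (Fin 3 → ℝ) := {x | 0 ≤ x 0 ∧ 0 ≤ x 1 ∧ 0 ≤ x 2 ∧ x 0 + x 1 + x 2 ≤ 1}

lemma isClosed_corner : IsClosed corner := by
  unfold corner
  refine (isClosed_le ?_ ?_).and ((isClosed_le ?_ ?_).and ((isClosed_le ?_ ?_).and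
    (isClosed_le ?_ ?_))) <;> fun_prop

lemma isCompact_corner : IsCompact corner := by
  refine (isCompact_Icc (a := (0 : Fin 3 → ℝ)) (b := 1)).of_isClosed_subset isClosed_corner ?_
  rintro x ⟨h0, h1, h2, h3⟩
  refine ⟨fun i => ?_, fun i => ?_⟩ <;> fin_cases i <;> simp <;> linarith

lemma integral_eq_intervalIntegral_of_support {s : ℝ} {f : ℝ → ℂ} (hs : 0 ≤ s)
    (hf : ∀ x, x ∉ Set.Icc 0 s → f x = 0) :
    ∫ x, f x = ∫ x in (0 : ℝ)..s, f x := by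
  rw [intervalIntegral.integral_of_le hs, ← integral_Icc_eq_integral_Ioc,
    setIntegral_eq_integral_of_forall_compl_eq_zero hf]

/-- The integral over the corner as an iterated integral. -/
theorem setIntegral_corner {f : (Fin 3 → ℝ) → ℂ} (hf : ContinuousOn f corner) :
    ∫ x in corner, f x = ∫ x in (0 : ℝ)..1, ∫ y in (0 : ℝ)..(1 - x),
      ∫ z in (0 : ℝ)..(1 - x - y), f (vec (x, y, z)) := by
  obtain ⟨e, he, hmp⟩ := exists_measurableEquiv_vec
  have hint : Integrable (corner.indicator f) := by
    rw [integrable_indicator_iff isClosed_corner.measurableSet]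
    exact hf.integrableOn_compact isCompact_corner
  rw [← integral_indicator isClosed_corner.measurableSet,
    ← hmp.integral_comp' (g := corner.indicator f)]
  have hint2 : Integrable (fun p : ℝ × ℝ × ℝ => corner.indicator f (vec p))
      (volume.prod volume) := by
    have := (hmp.integrable_comp_emb e.measurableEmbedding (g := corner.indicator f)).2 hint
    rw [he] at this
    exact this
  rw [he]
  change ∫ p : ℝ × ℝ × ℝ, corner.indicator f (vec p) ∂(volume.prod volume) = _
  rw [integral_prod _ hint2]
  have hz : ∀ x y z : ℝ, (x < 0 ∨ y < 0 ∨ z < 0 ∨ 1 < x + y + z) →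
      corner.indicator f (vec (x, y, z)) = 0 := by
    intro x y z h
    refine Set.indicator_of_notMem ?_ _
    rintro ⟨h0, h1, h2, h3⟩
    simp only [vec, Matrix.cons_val_zero, Matrix.cons_val_one, Matrix.cons_val] at h0 h1 h2 h3
    rcases h with h | h | h | h <;> linarith
  have hvol : ∀ x, ∫ q : ℝ × ℝ, corner.indicator f (vec (x, q)) =
      ∫ q : ℝ × ℝ, corner.indicator f (vec (x, q)) ∂(volume.prod volume) := fun x => rfl
  rw [integral_eq_intervalIntegral_of_support zero_le_one]
  · refine intervalIntegral.integral_congr_ae' ?_ (by simp)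
    filter_upwards [hint2.prod_right_ae] with x hx hx01
    rw [hvol, integral_prod _ hx,
      integral_eq_intervalIntegral_of_support (s := 1 - x) (by linarith [hx01.2])]
    · refine intervalIntegral.integral_congr fun y hy => ?_
      rw [Set.uIcc_of_le (by linarith [hx01.2])] at hy
      rw [integral_eq_intervalIntegral_of_support (s := 1 - x - y) (by linarith [hy.2])]
      · refine intervalIntegral.integral_congr fun z hz => ?_
        rw [Set.uIcc_of_le (by linarith [hy.2])] at hz
        refine Set.indicator_of_mem ?_ _
        have := hx01.1
        have := hy.1
        have := hz.1
        have := hz.2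
        refine ⟨?_, ?_, ?_, ?_⟩ <;> simp [vec] <;> linarith
      · intro z hz'
        apply hz
        by_contra! h
        exact hz' ⟨h.2.2.1, by linarith⟩
    · intro y hy'
      refine integral_eq_zero_of_ae (Filter.Eventually.of_forall fun z => hz x y z ?_)
      by_contra! h
      exact hy' ⟨h.2.1, by linarith⟩
  · intro x hx'
    refine integral_eq_zero_of_ae (Filter.Eventually.of_forall fun q => hz x q.1 q.2 ?_)
    by_contra! h
    exact hx' ⟨h.1, by linarith⟩

/-- The fundamental theorem of calculus along a segment in the complex plane. -/
lemma integral_segment {S : Set ℂ} {g g' : ℂ → ℂ} (hg : ∀ z ∈ S, HasDerivAt g (g' z) z)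
    (hc : ContinuousOn g' S) {s : ℝ} (hs : 0 ≤ s) (p δ : ℂ) (hδ : δ ≠ 0)
    (hS : ∀ t ∈ Set.Icc 0 s, p + (t : ℂ) * δ ∈ S) :
    ∫ t in (0 : ℝ)..s, g' (p + (t : ℂ) * δ) = (g (p + (s : ℂ) * δ) - g p) / δ := by
  have hcont : ContinuousOn (fun t : ℝ => g' (p + (t : ℂ) * δ)) (Set.uIcc 0 s) := by
    rw [Set.uIcc_of_le hs]
    exact hc.comp (by fun_prop) hS
  have key := intervalIntegral.integral_eq_sub_of_hasDerivAt (a := 0) (b := s)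
    (f := fun t : ℝ => g (p + (t : ℂ) * δ) / δ) (f' := fun t : ℝ => g' (p + (t : ℂ) * δ)) ?_
    hcont.intervalIntegrable
  · rw [key]; simp; ring
  · intro t ht
    rw [Set.uIcc_of_le hs] at ht
    have h1 : HasDerivAt (fun t : ℝ => p + (t : ℂ) * δ) δ t := by
      simpa using ((Complex.ofRealCLM.hasDerivAt (x := t)).mul_const δ).const_add p
    have h2 := ((hg _ (hS t ht)).comp t h1).div_const δ
    rwa [mul_div_assoc, div_self hδ, mul_one] at h2

/-- The Hermite-Genocchi formula for divided differences at four points. -/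
theorem integral_corner_eq_dividedDifference {S : Set ℂ} (hSc : Convex ℝ S) {h h1 h2 h3 : ℂ → ℂ}
    (d1 : ∀ z ∈ S, HasDerivAt h (h1 z) z) (d2 : ∀ z ∈ S, HasDerivAt h1 (h2 z) z)
    (d3 : ∀ z ∈ S, HasDerivAt h2 (h3 z) z) (hc : ContinuousOn h3 S) {p a b c : ℂ}
    (hp : p ∈ S) (ha : a ∈ S) (hb : b ∈ S) (hcS : c ∈ S) (hpa : a ≠ p) (hpb : b ≠ p)
    (hpc : c ≠ p) (hab : a ≠ b) (hac : a ≠ c) (hbc : b ≠ c) :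
    ∫ x in (0 : ℝ)..1, ∫ y in (0 : ℝ)..(1 - x), ∫ z in (0 : ℝ)..(1 - x - y),
      h3 (p + (x : ℂ) * (a - p) + (y : ℂ) * (b - p) + (z : ℂ) * (c - p)) =
    h p / ((p - a) * (p - b) * (p - c)) + h a / ((a - p) * (a - b) * (a - c)) +
      h b / ((b - p) * (b - a) * (b - c)) + h c / ((c - p) * (c - a) * (c - b)) := by
  have hmem : ∀ x y z : ℝ, 0 ≤ x → 0 ≤ y → 0 ≤ z → x + y + z ≤ 1 →
      p + (x : ℂ) * (a - p) + (y : ℂ) * (b - p) + (z : ℂ) * (c - p) ∈ S := by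
    intro x y z hx hy hz hxyz
    have := hSc.sum_mem (t := Finset.univ) (w := ![1 - x - y - z, x, y, z]) (z := ![p, a, b, c])
      (by intro i _; fin_cases i <;> simp <;> linarith)
      (by simp [Fin.sum_univ_four]; ring)
      (by intro i _; fin_cases i <;> simpa)
    convert this using 1
    simp [Fin.sum_univ_four]; ring
  have c2 : ContinuousOn h2 S := fun z hz => (d3 z hz).continuousAt.continuousWithinAt
  have c1 : ContinuousOn h1 S := fun z hz => (d2 z hz).continuousAt.continuousWithinAt
  have hα : a - p ≠ 0 := sub_ne_zero.2 hpa
  have hβ : b - p ≠ 0 := sub_ne_zero.2 hpb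
  have hγ : c - p ≠ 0 := sub_ne_zero.2 hpc
  have hbc' : b - c ≠ 0 := sub_ne_zero.2 hbc
  have hab' : a - b ≠ 0 := sub_ne_zero.2 hab
  have hac' : a - c ≠ 0 := sub_ne_zero.2 hac
  -- the middle integral; `e3` below is the innermost one
  have e2 : ∀ x ∈ Set.Icc (0 : ℝ) 1, (∫ y in (0 : ℝ)..(1 - x), ∫ z in (0 : ℝ)..(1 - x - y),
      h3 (p + (x : ℂ) * (a - p) + (y : ℂ) * (b - p) + (z : ℂ) * (c - p))) =
      ((h1 (b + (x : ℂ) * (a - b)) - h1 (c + (x : ℂ) * (a - c))) / (b - c) -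
        (h1 (b + (x : ℂ) * (a - b)) - h1 (p + (x : ℂ) * (a - p))) / (b - p)) / (c - p) := by
    intro x hx
    have hx0 := hx.1
    have hx1 := hx.2
    have e3 : ∀ y ∈ Set.uIcc 0 (1 - x), (∫ z in (0 : ℝ)..(1 - x - y),
        h3 (p + (x : ℂ) * (a - p) + (y : ℂ) * (b - p) + (z : ℂ) * (c - p))) =
        (h2 (c + (x : ℂ) * (a - c) + (y : ℂ) * (b - c)) -
          h2 (p + (x : ℂ) * (a - p) + (y : ℂ) * (b - p))) / (c - p) := by
      intro y hy
      rw [Set.uIcc_of_le (by linarith)] at hy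
      have hy0 := hy.1
      have hy1 := hy.2
      rw [integral_segment d3 hc (by linarith) _ _ hγ
        (fun t ht => hmem x y t hx0 hy0 ht.1 (by linarith [ht.2]))]
      have : p + (x : ℂ) * (a - p) + (y : ℂ) * (b - p) + ((1 - x - y : ℝ) : ℂ) * (c - p) =
          c + (x : ℂ) * (a - c) + (y : ℂ) * (b - c) := by push_cast; ring
      rw [this]
    rw [intervalIntegral.integral_congr e3, intervalIntegral.integral_div]
    have m1 : ∀ t ∈ Set.Icc 0 (1 - x),
        c + (x : ℂ) * (a - c) + (t : ℂ) * (b - c) ∈ S := by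
      intro t ht
      convert hmem x t (1 - x - t) hx0 ht.1 (by linarith [ht.2]) (by linarith) using 1
      push_cast; ring
    have m2 : ∀ t ∈ Set.Icc 0 (1 - x),
        p + (x : ℂ) * (a - p) + (t : ℂ) * (b - p) ∈ S := by
      intro t ht
      convert hmem x t 0 hx0 ht.1 le_rfl (by linarith [ht.2]) using 1
      push_cast; ring
    have i1 : IntervalIntegrable (fun t : ℝ => h2 (c + (x : ℂ) * (a - c) + (t : ℂ) * (b - c)))
        volume 0 (1 - x) := by
      refine ContinuousOn.intervalIntegrable ?_
      rw [Set.uIcc_of_le (by linarith)]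
      exact c2.comp (by fun_prop) m1
    have i2 : IntervalIntegrable (fun t : ℝ => h2 (p + (x : ℂ) * (a - p) + (t : ℂ) * (b - p)))
        volume 0 (1 - x) := by
      refine ContinuousOn.intervalIntegrable ?_
      rw [Set.uIcc_of_le (by linarith)]
      exact c2.comp (by fun_prop) m2
    rw [intervalIntegral.integral_sub i1 i2,
      integral_segment d2 c2 (by linarith) _ _ hbc' m1,
      integral_segment d2 c2 (by linarith) _ _ hβ m2]
    have r1 : c + (x : ℂ) * (a - c) + ((1 - x : ℝ) : ℂ) * (b - c) = b + (x : ℂ) * (a - b) := by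
      push_cast; ring
    have r2 : p + (x : ℂ) * (a - p) + ((1 - x : ℝ) : ℂ) * (b - p) = b + (x : ℂ) * (a - b) := by
      push_cast; ring
    rw [r1, r2]
  rw [intervalIntegral.integral_congr (fun x hx => e2 x (by
    rwa [Set.uIcc_of_le zero_le_one] at hx)), intervalIntegral.integral_div]
  have m1 : ∀ t ∈ Set.Icc (0 : ℝ) 1, b + (t : ℂ) * (a - b) ∈ S := by
    intro t ht
    convert hmem t (1 - t) 0 ht.1 (by linarith [ht.2]) le_rfl (by linarith) using 1
    push_cast; ring
  have m2 : ∀ t ∈ Set.Icc (0 : ℝ) 1, c + (t : ℂ) * (a - c) ∈ S := by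
    intro t ht
    convert hmem t 0 (1 - t) ht.1 le_rfl (by linarith [ht.2]) (by linarith) using 1
    push_cast; ring
  have m3 : ∀ t ∈ Set.Icc (0 : ℝ) 1, p + (t : ℂ) * (a - p) ∈ S := by
    intro t ht
    convert hmem t 0 0 ht.1 le_rfl le_rfl (by linarith [ht.2]) using 1
    push_cast; ring
  have ii : ∀ q r : ℂ, (∀ t ∈ Set.Icc (0 : ℝ) 1, q + (t : ℂ) * (r - q) ∈ S) →
      IntervalIntegrable (fun t : ℝ => h1 (q + (t : ℂ) * (r - q))) volume 0 1 := by
    intro q r hm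
    refine ContinuousOn.intervalIntegrable ?_
    rw [Set.uIcc_of_le zero_le_one]
    exact c1.comp (by fun_prop) hm
  rw [intervalIntegral.integral_sub (((ii _ _ m1).sub (ii _ _ m2)).div_const _)
    (((ii _ _ m1).sub (ii _ _ m3)).div_const _), intervalIntegral.integral_div,
    intervalIntegral.integral_div, intervalIntegral.integral_sub (ii _ _ m1) (ii _ _ m2),
    intervalIntegral.integral_sub (ii _ _ m1) (ii _ _ m3),
    integral_segment d1 c1 zero_le_one _ _ hab' m1,
    integral_segment d1 c1 zero_le_one _ _ hac' m2,
    integral_segment d1 c1 zero_le_one _ _ hα m3]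
  simp only [Complex.ofReal_one, one_mul, add_sub_cancel]
  have hα2 : p - a ≠ 0 := sub_ne_zero.2 hpa.symm
  have hβ2 : p - b ≠ 0 := sub_ne_zero.2 hpb.symm
  have hγ2 : p - c ≠ 0 := sub_ne_zero.2 hpc.symm
  have hbc2 : c - b ≠ 0 := sub_ne_zero.2 hbc.symm
  have hab2 : b - a ≠ 0 := sub_ne_zero.2 hab.symm
  have hac2 : c - a ≠ 0 := sub_ne_zero.2 hac.symm
  rw [← neg_sub a p, ← neg_sub b p, ← neg_sub c p, ← neg_sub b c, ← neg_sub a b, ← neg_sub a c]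
  field_simp
  ring

/-! ### Decomposition of the body into tetrahedra -/

lemma exists_of_mem_convexHull_triple {a b c x : Fin 3 → ℝ} (hx : x ∈ convexHull ℝ {a, b, c}) :
    ∃ α β γ : ℝ, 0 ≤ α ∧ 0 ≤ β ∧ 0 ≤ γ ∧ α + β + γ = 1 ∧ x = α • a + β • b + γ • c := by
  have : x ∈ convexHull ℝ (insert a {b, c}) := hx
  rw [convexHull_insert (Set.insert_nonempty _ _), convexHull_pair] at this
  obtain ⟨_, rfl, _, ⟨s, t, hs, ht, hst, rfl⟩, s', t', hs', ht', hst', rfl⟩ :=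
    mem_convexJoin.1 this
  refine ⟨s', t' * s, t' * t, hs', mul_nonneg ht' hs, mul_nonneg ht' ht, ?_, ?_⟩
  · rw [add_assoc, ← mul_add, hst, mul_one, hst']
  · simp only [smul_add, smul_smul]; abel

/-- A ray from an interior point leaves the body at a boundary point. -/
lemma exists_mem_frontier_ray {K : ℕ} {v : Fin K → Fin 3 → ℝ} {o : Fin 3 → ℝ}
    (ho : o ∈ interior (body v)) {e : Fin 3 → ℝ} (he : e ≠ 0) :
    ∃ s : ℝ, 0 < s ∧ o + s • e ∈ frontier (body v) ∧ ∀ τ : ℝ, o + τ • e ∈ body v → τ ≤ s := by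
  have hcont : Continuous fun τ : ℝ => o + τ • e := by fun_prop
  set R : Set ℝ := (fun τ : ℝ => o + τ • e) ⁻¹' body v with hR
  have hclosed : IsClosed R := (isCompact_body v).isClosed.preimage hcont
  have hbdd : BddAbove R := by
    obtain ⟨C, hC⟩ := (isCompact_body v).isBounded.exists_norm_le
    refine ⟨(C + ‖o‖) / ‖e‖, fun τ hτ => ?_⟩
    rw [le_div_iff₀ (norm_pos_iff.2 he)]
    have h1 : ‖o + τ • e‖ ≤ C := hC _ hτ
    have h2 : τ • e = (o + τ • e) - o := by abel
    have h3 : ‖τ • e‖ ≤ ‖o + τ • e‖ + ‖o‖ := by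
      conv_lhs => rw [h2]
      exact norm_sub_le _ _
    rw [norm_smul, Real.norm_eq_abs] at h3
    have := mul_le_mul_of_nonneg_right (le_abs_self τ) (norm_nonneg e)
    linarith
  -- from an interior point of the body, the ray stays in the body for some time
  have hgo : ∀ σ : ℝ, o + σ • e ∈ interior (body v) → ∃ τ ∈ R, σ < τ := by
    intro σ hσ
    have h1 : R ∈ nhdsWithin σ (Set.Ioi σ) :=
      nhdsWithin_le_nhds (hcont.continuousAt.preimage_mem_nhds (mem_interior_iff_mem_nhds.1 hσ))
    obtain ⟨τ, hτ, hτ'⟩ := (Filter.Eventually.and h1 self_mem_nhdsWithin).exists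
    exact ⟨τ, hτ, hτ'⟩
  obtain ⟨τ, hτR, hτ⟩ := hgo 0 (by simpa using ho)
  have hmem : sSup R ∈ R := hclosed.csSup_mem ⟨τ, hτR⟩ hbdd
  refine ⟨sSup R, hτ.trans_le (le_csSup hbdd hτR), ⟨subset_closure hmem, fun hi => ?_⟩,
    fun τ hτ => le_csSup hbdd hτ⟩
  obtain ⟨τ', hτ'R, hτ'⟩ := hgo _ hi
  exact absurd (le_csSup hbdd hτ'R) (not_le.2 hτ')

/-- The solid tetrahedron with vertices `o`, `a`, `b`, `c`. -/
def tetrahedron (o a b c : Fin 3 → ℝ) : Set (Fin 3 → ℝ) :=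
  frame o (a - o) (b - o) (c - o) '' corner

/-- The part of a tetrahedron inside all four faces. -/
def openTetrahedron (o a b c : Fin 3 → ℝ) : Set (Fin 3 → ℝ) :=
  frame o (a - o) (b - o) (c - o) '' {x | 0 < x 0 ∧ 0 < x 1 ∧ 0 < x 2 ∧ x 0 + x 1 + x 2 < 1}

lemma isCompact_tetrahedron (o a b c : Fin 3 → ℝ) : IsCompact (tetrahedron o a b c) :=
  isCompact_corner.image (continuous_frame _ _ _ _)

lemma volume_tetrahedron_diff (o a b c : Fin 3 → ℝ) :
    volume (tetrahedron o a b c \ openTetrahedron o a b c) = 0 := by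
  set I : Set (Fin 3 → ℝ) := {x | 0 < x 0 ∧ 0 < x 1 ∧ 0 < x 2 ∧ x 0 + x 1 + x 2 < 1} with hI
  have hIo : IsOpen I := by
    refine (isOpen_lt ?_ ?_).and ((isOpen_lt ?_ ?_).and ((isOpen_lt ?_ ?_).and
      (isOpen_lt ?_ ?_))) <;> fun_prop
  have hconv : Convex ℝ corner := by
    rintro x ⟨hx0, hx1, hx2, hx3⟩ y ⟨hy0, hy1, hy2, hy3⟩ s t hs ht hst
    refine ⟨?_, ?_, ?_, ?_⟩ <;> simp only [Pi.add_apply, Pi.smul_apply, smul_eq_mul]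
    · positivity
    · positivity
    · positivity
    · nlinarith
  have hnull : volume (corner \ I) = 0 := by
    refine measure_mono_null ?_ (hconv.addHaar_frontier volume)
    rintro x ⟨hx, hxI⟩
    refine ⟨subset_closure hx, fun hxi => ?_⟩
    -- an interior point of the corner has room in every direction
    have hc : ∀ d : Fin 3 → ℝ, ∃ s : ℝ, 0 < s ∧ x + s • d ∈ corner := by
      intro d
      have hcd : Continuous fun s : ℝ => x + s • d := by fun_prop
      have h1 : ∀ᶠ s in nhdsWithin (0 : ℝ) (Set.Ioi 0), x + s • d ∈ corner :=
        nhdsWithin_le_nhds (hcd.continuousAt.preimage_mem_nhds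
          (by simpa using mem_interior_iff_mem_nhds.1 hxi))
      obtain ⟨s, hs, hs0⟩ := (h1.and self_mem_nhdsWithin).exists
      exact ⟨s, hs0, hs⟩
    apply hxI
    obtain ⟨s, hs, h0, h1, h2, -⟩ := hc (-1)
    obtain ⟨s', hs', -, -, -, h3⟩ := hc 1
    simp at h0 h1 h2 h3
    refine ⟨?_, ?_, ?_, ?_⟩ <;> linarith
  have : tetrahedron o a b c \ openTetrahedron o a b c ⊆
      frame o (a - o) (b - o) (c - o) '' (corner \ I) := by
    rintro _ ⟨⟨x, hx, rfl⟩, hn⟩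
    exact ⟨x, ⟨hx, fun h => hn ⟨x, h, rfl⟩⟩, rfl⟩
  refine measure_mono_null this ?_
  exact addHaar_image_eq_zero_of_differentiableOn_of_addHaar_eq_zero volume
    (fun x _ => (hasFDerivAt_frame _ _ _ _ x).differentiableAt.differentiableWithinAt) hnull

section Triangulation

variable {K : ℕ} {v : Fin K → Fin 3 → ℝ} {T : Finset (Fin K × Fin K × Fin K)} {o : Fin 3 → ℝ}

lemma IsBoundaryTriangulation.triple_pos (hT : IsBoundaryTriangulation v T)
    (ho : o ∈ interior (body v)) {t : Fin K × Fin K × Fin K} (ht : t ∈ T) :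
    0 < triple (v t.1 - o) (v t.2.1 - o) (v t.2.2 - o) := by
  have h := dotProduct_sub_neg_of_mem_interior (hT.nondeg t ht) (hT.outward t ht) ho
  rw [← triNormal_dotProduct, ← neg_sub o (v t.1), dotProduct_neg]
  linarith

lemma IsBoundaryTriangulation.subset_frontier (hT : IsBoundaryTriangulation v T)
    {t : Fin K × Fin K × Fin K} (ht : t ∈ T) :
    convexHull ℝ {v t.1, v t.2.1, v t.2.2} ⊆ frontier (body v) := by
  rw [← hT.cover]
  exact Set.subset_biUnion_of_mem (u := fun t : Fin K × Fin K × Fin K =>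
    convexHull ℝ {v t.1, v t.2.1, v t.2.2}) ht

/-- The tetrahedra over the boundary triangles with apex at an interior point fill the body. -/
lemma IsBoundaryTriangulation.iUnion_tetrahedron (hT : IsBoundaryTriangulation v T)
    (ho : o ∈ interior (body v)) :
    ⋃ t : T, tetrahedron o (v t.1.1) (v t.1.2.1) (v t.1.2.2) = body v := by
  refine Set.Subset.antisymm (Set.iUnion_subset ?_) ?_
  · rintro ⟨t, ht⟩ _ ⟨x, ⟨h0, h1, h2, h3⟩, rfl⟩
    have := (convex_body v).sum_mem (t := Finset.univ)
      (w := ![1 - x 0 - x 1 - x 2, x 0, x 1, x 2]) (z := ![o, v t.1, v t.2.1, v t.2.2])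
      (by intro i _; fin_cases i <;> simp <;> linarith)
      (by simp [Fin.sum_univ_four]; ring)
      (by
        intro i _
        fin_cases i
        · exact interior_subset ho
        · exact vertex_mem_body v _
        · exact vertex_mem_body v _
        · exact vertex_mem_body v _)
    convert this using 1
    ext i
    simp [Fin.sum_univ_four, frame]; ring
  · intro x hx
    obtain ⟨e, he, τ, hτ0, hτ⟩ : ∃ e : Fin 3 → ℝ, e ≠ 0 ∧ ∃ τ : ℝ, 0 ≤ τ ∧ x = o + τ • e := by
      by_cases hxo : x = o
      · exact ⟨1, one_ne_zero, 0, le_rfl, by simp [hxo]⟩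
      · exact ⟨x - o, sub_ne_zero.2 hxo, 1, zero_le_one, by simp⟩
    obtain ⟨s, hs, hsf, hsm⟩ := exists_mem_frontier_ray ho he
    have hτs := hsm τ (hτ ▸ hx)
    rw [← hT.cover] at hsf
    simp only [Set.mem_iUnion] at hsf
    obtain ⟨t, ht, hy⟩ := hsf
    obtain ⟨α, β, γ, hα, hβ, hγ, hsum, hy⟩ := exists_of_mem_convexHull_triple hy
    refine Set.mem_iUnion.2 ⟨⟨t, ht⟩, (τ / s) • ![α, β, γ], ⟨?_, ?_, ?_, ?_⟩, ?_⟩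
    · simp; positivity
    · simp; positivity
    · simp; positivity
    · simp only [Pi.smul_apply, smul_eq_mul, Matrix.cons_val_zero, Matrix.cons_val_one,
        Matrix.cons_val]
      rw [← mul_add, ← mul_add, hsum, mul_one]
      exact div_le_one_of_le₀ hτs hs.le
    · have h1 : τ • e = (τ / s) • (s • e) := by rw [smul_smul, div_mul_cancel₀ _ hs.ne']
      have h2 : s • e = α • v t.1 + β • v t.2.1 + γ • v t.2.2 - (α + β + γ) • o := by
        rw [← hy, hsum, one_smul]; abel
      rw [hτ, h1, h2]
      ext i
      simp [frame]; ring

/-- Overlapping tetrahedra would have overlapping boundary triangles, since a ray from the apex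
meets the boundary only once. -/
lemma IsBoundaryTriangulation.disjoint_openTetrahedron (hT : IsBoundaryTriangulation v T)
    (ho : o ∈ interior (body v)) {t t' : Fin K × Fin K × Fin K} (ht : t ∈ T) (ht' : t' ∈ T)
    (hne : t ≠ t') :
    Disjoint (openTetrahedron o (v t.1) (v t.2.1) (v t.2.2))
      (openTetrahedron o (v t'.1) (v t'.2.1) (v t'.2.2)) := by
  -- a point of the open tetrahedron lies between the apex and a point of the open triangle
  have key : ∀ t ∈ T, ∀ y ∈ openTetrahedron o (v t.1) (v t.2.1) (v t.2.2), ∃ σ : ℝ, 0 < σ ∧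
      ∃ p ∈ openTriangle (v t.1) (v t.2.1) (v t.2.2), p ∈ frontier (body v) ∧
        y = o + σ • (p - o) := by
    rintro t ht _ ⟨x, ⟨h0, h1, h2, h3⟩, rfl⟩
    have hσ : 0 < x 0 + x 1 + x 2 := by positivity
    set σ := x 0 + x 1 + x 2 with hσd
    have hs : x 0 / σ + x 1 / σ + x 2 / σ = 1 := by
      rw [← add_div, ← add_div, ← hσd, div_self hσ.ne']
    refine ⟨σ, hσ, _, ⟨x 0 / σ, x 1 / σ, x 2 / σ, by positivity, by positivity, by positivity,
      hs, rfl⟩, ?_, ?_⟩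
    · exact hT.subset_frontier ht
        (mem_convexHull_triple (by positivity) (by positivity) (by positivity) hs)
    · ext i
      simp [frame]
      field_simp
      rw [hσd]; ring
  -- of two boundary points on a ray from the apex, the nearer would be interior to the body
  have hlt : ∀ σ σ' : ℝ, 0 < σ → 0 < σ' → ∀ p ∈ frontier (body v), ∀ p' ∈ frontier (body v),
      o + σ • (p - o) = o + σ' • (p' - o) → σ' ≤ σ → σ' = σ := by
    intro σ σ' hσ hσ' p hp p' hp' h hle
    by_contra hne
    have hlt : σ' < σ := lt_of_le_of_ne hle hne
    refine hp.2 ?_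
    have h1 : p = (1 - σ' / σ) • o + (σ' / σ) • p' := by
      have h2 : σ • (p - o) = σ' • (p' - o) := add_left_cancel h
      have h3 : p - o = (σ' / σ) • (p' - o) := by
        rw [div_eq_inv_mul, mul_smul, ← h2, smul_smul, inv_mul_cancel₀ hσ.ne', one_smul]
      rw [sub_smul, one_smul, sub_add_eq_add_sub, add_sub_assoc, ← smul_sub, ← h3]; abel
    rw [h1]
    exact (convex_body v).combo_interior_self_mem_interior ho
      ((isCompact_body v).isClosed.frontier_subset hp') (by rw [sub_pos, div_lt_one hσ]; exact hlt)
      (by positivity) (by ring)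
  rw [Set.disjoint_left]
  intro y hy hy'
  obtain ⟨σ, hσ, p, hp, hpf, hyp⟩ := key t ht y hy
  obtain ⟨σ', hσ', p', hp', hpf', hyp'⟩ := key t' ht' y hy'
  have hσσ : σ = σ' := by
    rcases le_total σ σ' with h | h
    · exact hlt σ' σ hσ' hσ p' hpf' p hpf (hyp'.symm.trans hyp) h
    · exact (hlt σ σ' hσ hσ' p hpf p' hpf' (hyp.symm.trans hyp') h).symm
  have hpp : p = p' := by
    have h2 : σ • (p - o) = σ' • (p' - o) := add_left_cancel (hyp.symm.trans hyp')
    rw [hσσ] at h2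
    exact sub_left_injective (smul_right_injective _ hσ'.ne' h2)
  exact Set.disjoint_left.1 (hT.disjoint t ht t' ht' hne) hp (hpp ▸ hp')

/-- An integral over the body is a sum over the tetrahedra on the boundary triangles. -/
theorem IsBoundaryTriangulation.setIntegral_body (hT : IsBoundaryTriangulation v T)
    (ho : o ∈ interior (body v)) {f : (Fin 3 → ℝ) → ℂ} (hf : IntegrableOn f (body v)) :
    ∫ r in body v, f r =
      ∑ t ∈ T, ∫ r in tetrahedron o (v t.1) (v t.2.1) (v t.2.2), f r := by
  have hU := hT.iUnion_tetrahedron ho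
  rw [← hU] at hf ⊢
  rw [integral_iUnion_ae (fun t => (isCompact_tetrahedron _ _ _ _).measurableSet.nullMeasurableSet)
    ?_ hf, tsum_fintype, Finset.sum_coe_sort T fun t =>
      ∫ r in tetrahedron o (v t.1) (v t.2.1) (v t.2.2), f r]
  rintro ⟨t, ht⟩ ⟨t', ht'⟩ hne
  have hdis := hT.disjoint_openTetrahedron ho ht ht' fun h => hne (Subtype.ext h)
  refine measure_mono_null ?_ (measure_union_null
    (volume_tetrahedron_diff o (v t.1) (v t.2.1) (v t.2.2))
    (volume_tetrahedron_diff o (v t'.1) (v t'.2.1) (v t'.2.2)))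
  rintro y ⟨hy, hy'⟩
  by_cases h : y ∈ openTetrahedron o (v t.1) (v t.2.1) (v t.2.2)
  · exact Or.inr ⟨hy', Set.disjoint_left.1 hdis h⟩
  · exact Or.inl ⟨hy, h⟩

end Triangulation

lemma toComplex_proj_frame (ux uy : Fin 3 → ℝ) (sx sy : ℝ) (o a b c x : Fin 3 → ℝ) :
    toComplex (proj ux uy sx sy (frame o (a - o) (b - o) (c - o) x)) =
      toComplex (proj ux uy sx sy o) +
      (x 0 : ℂ) * (toComplex (proj ux uy sx sy a) - toComplex (proj ux uy sx sy o)) +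
      (x 1 : ℂ) * (toComplex (proj ux uy sx sy b) - toComplex (proj ux uy sx sy o)) +
      (x 2 : ℂ) * (toComplex (proj ux uy sx sy c) - toComplex (proj ux uy sx sy o)) := by
  simp only [toComplex, proj, frame, add_dotProduct, smul_dotProduct, sub_dotProduct,
    smul_eq_mul]
  push_cast
  ring

lemma continuous_toComplex_proj (ux uy : Fin 3 → ℝ) (sx sy : ℝ) :
    Continuous fun r => toComplex (proj ux uy sx sy r) := by
  simp only [toComplex, proj, dotProduct, Fin.sum_univ_three]
  fun_prop

lemma convex_image_toComplex_proj (ux uy : Fin 3 → ℝ) (sx sy : ℝ) {B : Set (Fin 3 → ℝ)}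
    (hB : Convex ℝ B) : Convex ℝ ((fun r => toComplex (proj ux uy sx sy r)) '' B) := by
  rintro _ ⟨x, hx, rfl⟩ _ ⟨y, hy, rfl⟩ s t hs ht hst
  refine ⟨s • x + t • y, hB hx hy hs ht hst, ?_⟩
  have ht' : t = 1 - s := by linarith
  subst ht'
  simp only [toComplex, proj, add_dotProduct, smul_dotProduct, smul_eq_mul, Complex.real_smul]
  push_cast
  ring

lemma hasDerivAt_iteratedDeriv {h : ℂ → ℂ} {z : ℂ} (hz : AnalyticAt ℂ h z) (n : ℕ) :
    HasDerivAt (iteratedDeriv n h) (iteratedDeriv (n + 1) h z) z := by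
  rw [iteratedDeriv_succ, iteratedDeriv_eq_iterate]
  exact (hz.iterated_deriv n).differentiableAt.hasDerivAt

/-! ### Coordinates along and across the beam -/

lemma dotProduct_eq_zero_of_unit_cross {ux uy : Fin 3 → ℝ} (hux : ux ⬝ᵥ ux = 1) (huy : uy ⬝ᵥ uy = 1)
    (hd : (ux ⨯₃ uy) ⬝ᵥ (ux ⨯₃ uy) = 1) : ux ⬝ᵥ uy = 0 := by
  rw [cross_dot_cross, hux, huy, dotProduct_comm uy ux] at hd
  have : (ux ⬝ᵥ uy) * (ux ⬝ᵥ uy) = 0 := by linarith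
  exact mul_self_eq_zero.1 this

lemma triple_cross_eq_one {ux uy : Fin 3 → ℝ} (hd : (ux ⨯₃ uy) ⬝ᵥ (ux ⨯₃ uy) = 1) :
    triple ux uy (ux ⨯₃ uy) = 1 := by
  rw [← triple_rotate, ← triple_rotate]
  exact hd

lemma eq_smul_cross_of_dotProduct_eq_zero {ux uy : Fin 3 → ℝ} (hux : ux ⬝ᵥ ux = 1)
    (huy : uy ⬝ᵥ uy = 1) (hd : (ux ⨯₃ uy) ⬝ᵥ (ux ⨯₃ uy) = 1)
    {x : Fin 3 → ℝ} (hx : x ⬝ᵥ ux = 0) (hy : x ⬝ᵥ uy = 0) :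
    ∃ a : ℝ, x = a • (ux ⨯₃ uy) := by
  have h0 := dotProduct_eq_zero_of_unit_cross hux huy hd
  have h := triple_smul_eq ux uy (ux ⨯₃ uy) x
  have h1 : triple x uy (ux ⨯₃ uy) = (x ⬝ᵥ ux) * (uy ⬝ᵥ uy) - (x ⬝ᵥ uy) * (ux ⬝ᵥ uy) := by
    simp [triple_eq, crossProduct, dotProduct, Fin.sum_univ_three]; ring
  have h2 : triple ux x (ux ⨯₃ uy) = (x ⬝ᵥ uy) * (ux ⬝ᵥ ux) - (x ⬝ᵥ ux) * (ux ⬝ᵥ uy) := by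
    simp [triple_eq, crossProduct, dotProduct, Fin.sum_univ_three]; ring
  rw [triple_cross_eq_one hd, h1, h2, hx, hy, one_smul] at h
  exact ⟨_, by simpa using h⟩

lemma zVertex_injective {ux uy : Fin 3 → ℝ} (hux : ux ⬝ᵥ ux = 1) (huy : uy ⬝ᵥ uy = 1)
    (hd : (ux ⨯₃ uy) ⬝ᵥ (ux ⨯₃ uy) = 1)
    {K : ℕ} {v : Fin K → Fin 3 → ℝ}
    (hcol : ∀ k k' : Fin K, k ≠ k' → ∀ a : ℝ, v k - v k' ≠ a • (ux ⨯₃ uy)) (sx sy : ℝ) :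
    Function.Injective (zVertex v ux uy sx sy) := by
  intro k k' h
  by_contra hne
  have hre := congrArg Complex.re h
  have him := congrArg Complex.im h
  simp [zVertex, toComplex, proj] at hre him
  obtain ⟨a, ha⟩ := eq_smul_cross_of_dotProduct_eq_zero hux huy hd (x := v k - v k')
    (by rw [sub_dotProduct, hre, sub_self]) (by rw [sub_dotProduct, him, sub_self])
  exact hcol k k' hne a ha

lemma proj_line {ux uy : Fin 3 → ℝ} (hux : ux ⬝ᵥ ux = 1) (huy : uy ⬝ᵥ uy = 1)
    (hd : (ux ⨯₃ uy) ⬝ᵥ (ux ⨯₃ uy) = 1)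
    (sx sy : ℝ) (p : ℝ × ℝ) (t : ℝ) :
    proj ux uy sx sy ((p.1 - sx) • ux + (p.2 - sy) • uy + t • (ux ⨯₃ uy)) = p := by
  have h0 := dotProduct_eq_zero_of_unit_cross hux huy hd
  have h1 : (ux ⨯₃ uy) ⬝ᵥ ux = 0 := by rw [dotProduct_comm, dot_self_cross]
  have h2 : (ux ⨯₃ uy) ⬝ᵥ uy = 0 := by rw [dotProduct_comm, dot_cross_self]
  simp [proj, add_dotProduct, smul_dotProduct, hux, huy, h0, h1, h2, dotProduct_comm uy ux]

lemma measurePreserving_line {ux uy : Fin 3 → ℝ} (hd : (ux ⨯₃ uy) ⬝ᵥ (ux ⨯₃ uy) = 1)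
    (sx sy : ℝ) :
    MeasurePreserving (fun q : (ℝ × ℝ) × ℝ =>
      (q.1.1 - sx) • ux + (q.1.2 - sy) • uy + q.2 • (ux ⨯₃ uy)) := by
  obtain ⟨e, he, hmp⟩ := exists_measurableEquiv_vec
  have hdet : LinearMap.det (Matrix.toLin' (Matrix.of ![ux, uy, ux ⨯₃ uy])ᵀ) = 1 := by
    rw [LinearMap.det_toLin', Matrix.det_transpose, ← triple_cross_eq_one hd,
      Matrix.det_fin_three, triple_eq]
    simp only [Matrix.of_apply, Matrix.cons_val_zero, Matrix.cons_val_one, Matrix.cons_val]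
    ring
  have hlin : MeasurePreserving (Matrix.toLin' (Matrix.of ![ux, uy, ux ⨯₃ uy])ᵀ) := by
    refine ⟨(LinearMap.continuous_of_finiteDimensional _).measurable, ?_⟩
    rw [Real.map_linearMap_volume_pi_eq_smul_volume_pi (by rw [hdet]; exact one_ne_zero), hdet]
    simp
  have hcomp := ((measurePreserving_add_left volume (-(sx • ux) - sy • uy)).comp
    (hlin.comp hmp)).comp
    (volume_preserving_prodAssoc (α₁ := ℝ) (β₁ := ℝ) (γ₁ := ℝ))
  refine (congrArg (fun f => MeasurePreserving f volume volume) ?_).mpr hcomp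
  funext q
  ext i
  simp [he, vec, MeasurableEquiv.prodAssoc, Matrix.mulVec, dotProduct, Fin.sum_univ_three]
  ring

lemma beam_eq_zero {K : ℕ} (v : Fin K → Fin 3 → ℝ) {ux uy : Fin 3 → ℝ} (hux : ux ⬝ᵥ ux = 1)
    (huy : uy ⬝ᵥ uy = 1) (hd : (ux ⨯₃ uy) ⬝ᵥ (ux ⨯₃ uy) = 1) (sx sy : ℝ) {p : ℝ × ℝ}
    (hp : p ∉ proj ux uy sx sy '' body v) : beam v ux uy sx sy p = 0 := by
  rw [beam]
  refine integral_eq_zero_of_ae (Filter.Eventually.of_forall fun t => ?_)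
  exact Set.indicator_of_notMem
    (fun h => hp ⟨_, h, proj_line hux huy hd sx sy p t⟩) _

/-- Fubini's theorem in coordinates along and across the beam. -/
theorem integrable_beam_mul {K : ℕ} (v : Fin K → Fin 3 → ℝ) {ux uy : Fin 3 → ℝ}
    (hux : ux ⬝ᵥ ux = 1) (huy : uy ⬝ᵥ uy = 1) (hd : (ux ⨯₃ uy) ⬝ᵥ (ux ⨯₃ uy) = 1) (sx sy : ℝ)
    {f : ℝ × ℝ → ℂ} (hf : ContinuousOn (fun r => f (proj ux uy sx sy r)) (body v)) :
    Integrable (fun p => (beam v ux uy sx sy p : ℂ) * f p) ∧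
      ∫ p, (beam v ux uy sx sy p : ℂ) * f p = ∫ r in body v, f (proj ux uy sx sy r) := by
  set Ψ : (ℝ × ℝ) × ℝ → Fin 3 → ℝ := fun q =>
    (q.1.1 - sx) • ux + (q.1.2 - sy) • uy + q.2 • (ux ⨯₃ uy) with hΨ
  have hmp : MeasurePreserving Ψ := measurePreserving_line hd sx sy
  have hinj : Function.Injective Ψ := by
    intro q q' h
    have h1 : q.1 = q'.1 := by
      rw [← proj_line hux huy hd sx sy q.1 q.2, ← proj_line hux huy hd sx sy q'.1 q'.2]
      exact congrArg _ h
    refine Prod.ext h1 ?_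
    have h2 : q.2 • (ux ⨯₃ uy) = q'.2 • (ux ⨯₃ uy) := by
      simp only [hΨ, h1] at h
      exact add_left_cancel h
    have h3 := congrArg (fun x => x ⬝ᵥ (ux ⨯₃ uy)) h2
    simpa [smul_dotProduct, hd] using h3
  have hemb : MeasurableEmbedding Ψ := by
    refine Continuous.measurableEmbedding ?_ hinj
    simp only [hΨ]; fun_prop
  have hbm : MeasurableSet (body v) := (isCompact_body v).isClosed.measurableSet
  set G : (Fin 3 → ℝ) → ℂ := (body v).indicator fun r => f (proj ux uy sx sy r) with hG
  have hGi : Integrable G := by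
    rw [hG, integrable_indicator_iff hbm]
    exact hf.integrableOn_compact (isCompact_body v)
  have hJ : (fun q => G (Ψ q)) = fun q => (model v (Ψ q) : ℂ) * f q.1 := by
    funext q
    have hq : proj ux uy sx sy (Ψ q) = q.1 := proj_line hux huy hd sx sy q.1 q.2
    by_cases h : Ψ q ∈ body v
    · simp [hG, model, h, hq]
    · simp [hG, model, h]
  have hJi : Integrable (fun q : (ℝ × ℝ) × ℝ => (model v (Ψ q) : ℂ) * f q.1)
      (volume.prod volume) := by
    rw [← hJ]
    exact (hmp.integrable_comp_emb hemb).2 hGi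
  have hin : ∀ p : ℝ × ℝ, ∫ t : ℝ, (model v (Ψ (p, t)) : ℂ) * f p =
      (beam v ux uy sx sy p : ℂ) * f p := by
    intro p
    rw [integral_mul_const]
    exact congrArg (· * f p) (integral_ofReal (𝕜 := ℂ))
  have h1 := hJi.integral_prod_left
  simp only [hin] at h1
  refine ⟨h1, ?_⟩
  have h2 := integral_prod _ hJi
  simp only [hin] at h2
  rw [← h2, ← integral_indicator hbm, ← hmp.integral_comp hemb]
  exact congrArg (fun J => ∫ q, J q) hJ.symm

/-! ### The coefficients -/

/-- The factor of `h (z k)` in the divided difference of `h` at the projected vertices of the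
triangle `t`; it is zero if `v k` is not a vertex of `t`. -/
def dividedWeight {K : ℕ} (z : Fin K → ℂ) (t : Fin K × Fin K × Fin K) (k : Fin K) : ℂ :=
  (if t.1 = k then 1 / ((z k - z t.2.1) * (z k - z t.2.2)) else 0) +
  (if t.2.1 = k then 1 / ((z k - z t.1) * (z k - z t.2.2)) else 0) +
  (if t.2.2 = k then 1 / ((z k - z t.1) * (z k - z t.2.1)) else 0)

/-- The factor of `h (z k)` in the integral of the third derivative of `h` over the body, as
computed from the decomposition into tetrahedra with apex `o`, which is projected to `zo`. -/
def coneWeight {K : ℕ} (v : Fin K → Fin 3 → ℝ) (z : Fin K → ℂ) (zo : ℂ) (o : Fin 3 → ℝ)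
    (T : Finset (Fin K × Fin K × Fin K)) (k : Fin K) : ℂ :=
  ∑ t ∈ T, (triple (v t.1 - o) (v t.2.1 - o) (v t.2.2 - o) : ℂ) *
    (dividedWeight z t k / (z k - zo))

/-- The factor of `h` at the projection of the apex in the same computation. -/
def apexWeight {K : ℕ} (v : Fin K → Fin 3 → ℝ) (z : Fin K → ℂ) (zo : ℂ) (o : Fin 3 → ℝ)
    (T : Finset (Fin K × Fin K × Fin K)) : ℂ :=
  ∑ t ∈ T, (triple (v t.1 - o) (v t.2.1 - o) (v t.2.2 - o) : ℂ) /
    ((zo - z t.1) * (zo - z t.2.1) * (zo - z t.2.2))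

lemma ne_of_triple_pos {K : ℕ} {v : Fin K → Fin 3 → ℝ} {o : Fin 3 → ℝ} {i j k : Fin K}
    (h : 0 < triple (v i - o) (v j - o) (v k - o)) : i ≠ j ∧ i ≠ k ∧ j ≠ k := by
  refine ⟨?_, ?_, ?_⟩ <;> rintro rfl <;> refine h.ne' ?_ <;> simp only [triple_eq] <;> ring

/-- The integral of the third derivative of `h` over the body, by the Hermite-Genocchi formula on
the tetrahedra with apex `o`. -/
theorem setIntegral_body_eq_coneWeight {K : ℕ} {v : Fin K → Fin 3 → ℝ}
    {T : Finset (Fin K × Fin K × Fin K)} (hT : IsBoundaryTriangulation v T) {ux uy : Fin 3 → ℝ}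
    {sx sy : ℝ} (hz : Function.Injective (zVertex v ux uy sx sy)) {o : Fin 3 → ℝ}
    (ho : o ∈ interior (body v))
    (hzo : ∀ k, zVertex v ux uy sx sy k ≠ toComplex (proj ux uy sx sy o)) {h : ℂ → ℂ}
    (hh : AnalyticOnNhd ℂ h ((fun r => toComplex (proj ux uy sx sy r)) '' body v)) :
    ∫ r in body v, iteratedDeriv 3 h (toComplex (proj ux uy sx sy r)) =
      apexWeight v (zVertex v ux uy sx sy) (toComplex (proj ux uy sx sy o)) o T *
          h (toComplex (proj ux uy sx sy o)) +
        ∑ k, coneWeight v (zVertex v ux uy sx sy) (toComplex (proj ux uy sx sy o)) o T k *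
          h (zVertex v ux uy sx sy k) := by
  set ζ : (Fin 3 → ℝ) → ℂ := fun r => toComplex (proj ux uy sx sy r) with hζ
  set z := zVertex v ux uy sx sy with hzd
  have hzζ : ∀ k, z k = ζ (v k) := fun k => rfl
  set S := ζ '' body v with hS
  have hSc : Convex ℝ S := convex_image_toComplex_proj ux uy sx sy (convex_body v)
  have hζc : Continuous ζ := continuous_toComplex_proj ux uy sx sy
  have hder : ∀ n, ∀ w ∈ S, HasDerivAt (iteratedDeriv n h) (iteratedDeriv (n + 1) h w) w :=
    fun n w hw => hasDerivAt_iteratedDeriv (hh w hw) n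
  have hc3 : ContinuousOn (iteratedDeriv 3 h) S := fun w hw =>
    (hder 3 w hw).continuousAt.continuousWithinAt
  have hcb : ContinuousOn (fun r => iteratedDeriv 3 h (ζ r)) (body v) :=
    hc3.comp hζc.continuousOn fun r hr => ⟨r, hr, rfl⟩
  have hd1 := hder 0
  rw [iteratedDeriv_zero] at hd1
  have hoS : ζ o ∈ S := ⟨o, interior_subset ho, rfl⟩
  have hzS : ∀ k, z k ∈ S := fun k => ⟨v k, vertex_mem_body v k, rfl⟩
  rw [hT.setIntegral_body ho (hcb.integrableOn_compact (isCompact_body v))]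
  have htet : ∀ t ∈ T, ∫ r in tetrahedron o (v t.1) (v t.2.1) (v t.2.2),
      iteratedDeriv 3 h (ζ r) = (triple (v t.1 - o) (v t.2.1 - o) (v t.2.2 - o) : ℂ) *
        (h (ζ o) / ((ζ o - z t.1) * (ζ o - z t.2.1) * (ζ o - z t.2.2)) +
          h (z t.1) / ((z t.1 - ζ o) * (z t.1 - z t.2.1) * (z t.1 - z t.2.2)) +
          h (z t.2.1) / ((z t.2.1 - ζ o) * (z t.2.1 - z t.1) * (z t.2.1 - z t.2.2)) +
          h (z t.2.2) / ((z t.2.2 - ζ o) * (z t.2.2 - z t.1) * (z t.2.2 - z t.2.1))) := by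
    intro t ht
    have hD := hT.triple_pos ho ht
    obtain ⟨n1, n2, n3⟩ := ne_of_triple_pos hD
    have hsub : tetrahedron o (v t.1) (v t.2.1) (v t.2.2) ⊆ body v := by
      rw [← hT.iUnion_tetrahedron ho]
      exact Set.subset_iUnion (fun t : T => tetrahedron o (v t.1.1) (v t.1.2.1) (v t.1.2.2)) ⟨t, ht⟩
    rw [tetrahedron, setIntegral_image_frame hD.ne' isClosed_corner.measurableSet,
      setIntegral_corner, abs_of_pos hD, Complex.real_smul,
      ← integral_corner_eq_dividedDifference hSc hd1 (hder 1) (hder 2) hc3 hoS (hzS _) (hzS _)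
        (hzS _) (hzo _) (hzo _) (hzo _) (hz.ne n1) (hz.ne n2) (hz.ne n3)]
    · congr 1
      simp only [hζ, toComplex_proj_frame]
      simp only [vec, Matrix.cons_val_zero, Matrix.cons_val_one, Matrix.cons_val]
      rfl
    · exact hcb.comp (continuous_frame _ _ _ _).continuousOn fun x hx => hsub ⟨x, hx, rfl⟩
  rw [Finset.sum_congr rfl htet, apexWeight, Finset.sum_mul]
  simp only [coneWeight, Finset.sum_mul]
  rw [Finset.sum_comm, ← Finset.sum_add_distrib]
  refine Finset.sum_congr rfl fun t _ => ?_
  have hsum : ∑ k, (triple (v t.1 - o) (v t.2.1 - o) (v t.2.2 - o) : ℂ) *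
      (dividedWeight z t k / (z k - ζ o)) * h (z k) =
      (triple (v t.1 - o) (v t.2.1 - o) (v t.2.2 - o) : ℂ) *
      (1 / ((z t.1 - z t.2.1) * (z t.1 - z t.2.2)) / (z t.1 - ζ o) * h (z t.1) +
      1 / ((z t.2.1 - z t.1) * (z t.2.1 - z t.2.2)) / (z t.2.1 - ζ o) * h (z t.2.1) +
      1 / ((z t.2.2 - z t.1) * (z t.2.2 - z t.2.1)) / (z t.2.2 - ζ o) * h (z t.2.2)) := by
    simp only [dividedWeight, mul_assoc, ← Finset.mul_sum, add_div, add_mul, Finset.sum_add_distrib,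
      ite_div, ite_mul, zero_div, zero_mul, Finset.sum_ite_eq, Finset.mem_univ, if_true]
  rw [hsum]
  simp only [div_eq_mul_inv, mul_inv, one_mul]
  ring

/-- Point evaluations at distinct points are linearly independent on polynomials. -/
lemma eq_zero_of_forall_polynomial {ι : Type*} [Fintype ι] {z : ι → ℂ}
    (hz : Function.Injective z) {ρ : ι → ℂ}
    (h : ∀ p : Polynomial ℂ, ∑ i, ρ i * p.eval (z i) = 0) (i : ι) : ρ i = 0 := by
  classical
  have h1 := h (Lagrange.basis Finset.univ z i)
  rw [Finset.sum_eq_single i] at h1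
  · rwa [Lagrange.eval_basis_self hz.injOn (Finset.mem_univ i), mul_one] at h1
  · intro j _ hj
    rw [Lagrange.eval_basis_of_ne hj.symm (Finset.mem_univ j), mul_zero]
  · simp

lemma analyticOnNhd_polynomial (p : Polynomial ℂ) (S : Set ℂ) :
    AnalyticOnNhd ℂ (fun z => p.eval z) S := fun z _ => p.differentiable.analyticAt z

/-- The computed weights do not depend on the apex, and the weight at the apex vanishes. -/
lemma apexWeight_eq_zero_and_coneWeight_eq {K : ℕ} {v : Fin K → Fin 3 → ℝ}
    {T : Finset (Fin K × Fin K × Fin K)} (hT : IsBoundaryTriangulation v T) {ux uy : Fin 3 → ℝ}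
    {sx sy : ℝ} (hz : Function.Injective (zVertex v ux uy sx sy)) {o o' : Fin 3 → ℝ}
    (ho : o ∈ interior (body v)) (ho' : o' ∈ interior (body v))
    (hzo : ∀ k, zVertex v ux uy sx sy k ≠ toComplex (proj ux uy sx sy o))
    (hzo' : ∀ k, zVertex v ux uy sx sy k ≠ toComplex (proj ux uy sx sy o'))
    (hne : toComplex (proj ux uy sx sy o) ≠ toComplex (proj ux uy sx sy o')) :
    apexWeight v (zVertex v ux uy sx sy) (toComplex (proj ux uy sx sy o)) o T = 0 ∧
    ∀ k, coneWeight v (zVertex v ux uy sx sy) (toComplex (proj ux uy sx sy o)) o T k =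
      coneWeight v (zVertex v ux uy sx sy) (toComplex (proj ux uy sx sy o')) o' T k := by
  set z := zVertex v ux uy sx sy with hzd
  set a := toComplex (proj ux uy sx sy o) with ha
  set a' := toComplex (proj ux uy sx sy o') with ha'
  -- the two formulas involve the values of `h` at the `K + 2` distinct points `a`, `a'`, `z k`
  let Z : Option (Option (Fin K)) → ℂ := fun i => i.elim a fun i => i.elim a' z
  let ρ : Option (Option (Fin K)) → ℂ := fun i => i.elim (apexWeight v z a o T) fun i =>
    i.elim (-apexWeight v z a' o' T) fun k => coneWeight v z a o T k - coneWeight v z a' o' T k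
  have hZ : Function.Injective Z := by
    rintro (_ | _ | i) (_ | _ | j) hij
    · rfl
    · exact absurd hij hne
    · exact absurd hij.symm (hzo j)
    · exact absurd hij.symm hne
    · rfl
    · exact absurd hij.symm (hzo' j)
    · exact absurd hij (hzo i)
    · exact absurd hij (hzo' i)
    · rw [hz hij]
  have hρ : ∀ i, ρ i = 0 := by
    refine eq_zero_of_forall_polynomial hZ fun p => ?_
    have e1 := setIntegral_body_eq_coneWeight hT hz ho hzo (analyticOnNhd_polynomial p _)
    have e2 := setIntegral_body_eq_coneWeight hT hz ho' hzo' (analyticOnNhd_polynomial p _)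
    rw [e1] at e2
    simp only [Fintype.sum_option, ρ, Z, Option.elim, sub_mul, Finset.sum_sub_distrib]
    linear_combination e2
  exact ⟨hρ none, fun k => sub_eq_zero.1 (hρ (some (some k)))⟩

/-- Up to the factor `z k - zo`, the weight at `v k` is an affine function of the apex `o`: every
tetrahedron with vertex `v k` over a triangle with normal `n` has the volume `n · (v k - o) / 6`. -/
lemma coneWeight_mul {K : ℕ} (v : Fin K → Fin 3 → ℝ) (z : Fin K → ℂ) {zo : ℂ} (o : Fin 3 → ℝ)
    (T : Finset (Fin K × Fin K × Fin K)) {k : Fin K} (hzo : z k ≠ zo) :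
    coneWeight v z zo o T k * (z k - zo) =
      ∑ t ∈ T, ((triNormal (v t.1) (v t.2.1) (v t.2.2) ⬝ᵥ (v k - o) : ℝ) : ℂ) *
        dividedWeight z t k := by
  rw [coneWeight, Finset.sum_mul]
  refine Finset.sum_congr rfl fun t _ => ?_
  rw [mul_assoc, div_mul_cancel₀ _ (sub_ne_zero.2 hzo)]
  by_cases h1 : t.1 = k
  · rw [← triNormal_dotProduct, h1]
  by_cases h2 : t.2.1 = k
  · congr 2
    rw [← h2]
    simp [triple_eq, triNormal, crossProduct, dotProduct, Fin.sum_univ_three]; ring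
  by_cases h3 : t.2.2 = k
  · congr 2
    rw [← h3]
    simp [triple_eq, triNormal, crossProduct, dotProduct, Fin.sum_univ_three]; ring
  · simp [dividedWeight, h1, h2, h3]

lemma eventually_add_mul_ne (a b c : ℂ) (hb : b ≠ 0) :
    ∀ᶠ s : ℝ in nhdsWithin 0 (Set.Ioi 0), a + (s : ℂ) * b ≠ c := by
  by_cases hac : a = c
  · filter_upwards [self_mem_nhdsWithin] with s hs h
    rw [hac, add_eq_left, mul_eq_zero] at h
    exact h.elim (fun h => (Set.mem_Ioi.1 hs).ne' (by exact_mod_cast h)) hb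
  · refine nhdsWithin_le_nhds ?_
    have hc : Continuous fun s : ℝ => a + (s : ℂ) * b := by fun_prop
    exact hc.continuousAt.eventually_ne (by simpa using hac)

/-- Moving the apex along a direction `u` slightly keeps it in general position. -/
lemma exists_generic_shift {K : ℕ} {v : Fin K → Fin 3 → ℝ} {ux uy : Fin 3 → ℝ} {sx sy : ℝ}
    {o : Fin 3 → ℝ} (ho : o ∈ interior (body v)) (u : Fin 3 → ℝ) {b : ℂ} (hb : b ≠ 0)
    (hu : ∀ s : ℝ, toComplex (proj ux uy sx sy (o + s • u)) =
      toComplex (proj ux uy sx sy o) + (s : ℂ) * b) :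
    ∃ s : ℝ, 0 < s ∧ o + s • u ∈ interior (body v) ∧
      ∀ k, zVertex v ux uy sx sy k ≠ toComplex (proj ux uy sx sy (o + s • u)) := by
  have hc : Continuous fun s : ℝ => o + s • u := by fun_prop
  have h1 : ∀ᶠ s in nhdsWithin (0 : ℝ) (Set.Ioi 0), o + s • u ∈ interior (body v) :=
    nhdsWithin_le_nhds (hc.continuousAt.preimage_mem_nhds
      (isOpen_interior.mem_nhds (by simpa using ho)))
  have h2 : ∀ᶠ s in nhdsWithin (0 : ℝ) (Set.Ioi 0), ∀ k,
      zVertex v ux uy sx sy k ≠ toComplex (proj ux uy sx sy (o + s • u)) := by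
    rw [Filter.eventually_all]
    intro k
    filter_upwards [eventually_add_mul_ne (toComplex (proj ux uy sx sy o)) b
      (zVertex v ux uy sx sy k) hb] with s hs
    rw [hu]
    exact hs.symm
  obtain ⟨s, hs1, hs2, hs0⟩ := (h1.and (h2.and self_mem_nhdsWithin)).exists
  exact ⟨s, hs0, hs1, hs2⟩

/-- The integral of the third derivative of `h` over the body is given by the coefficients of any
triangulation: the weights `ρ k` do not depend on the apex `o`, and moving `o` by `s ux` or `s uy`
in `coneWeight_mul` shows that `ρ k` and `i ρ k` are the sums of `n · ux` and `n · uy` times the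
factors `dividedWeight`. -/
theorem setIntegral_body_eq_coeff {K : ℕ} {v : Fin K → Fin 3 → ℝ}
    {T : Finset (Fin K × Fin K × Fin K)} (hT : IsBoundaryTriangulation v T)
    (hv : affineSpan ℝ (Set.range v) = ⊤) {ux uy : Fin 3 → ℝ} (hux : ux ⬝ᵥ ux = 1)
    (huy : uy ⬝ᵥ uy = 1) (huxy : ux ⬝ᵥ uy = 0) {sx sy : ℝ}
    (hz : Function.Injective (zVertex v ux uy sx sy)) {h : ℂ → ℂ}
    (hh : AnalyticOnNhd ℂ h ((fun r => toComplex (proj ux uy sx sy r)) '' body v)) :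
    ∫ r in body v, iteratedDeriv 3 h (toComplex (proj ux uy sx sy r)) =
      ∑ k, coeff v ux uy sx sy T k * h (zVertex v ux uy sx sy k) := by
  have hsx : ∀ (o : Fin 3 → ℝ) (s : ℝ), toComplex (proj ux uy sx sy (o + s • ux)) =
      toComplex (proj ux uy sx sy o) + (s : ℂ) * 1 := by
    intro o s
    simp only [toComplex, proj, add_dotProduct, smul_dotProduct, hux, huxy, smul_eq_mul]
    push_cast; ring
  have hsy : ∀ (o : Fin 3 → ℝ) (s : ℝ), toComplex (proj ux uy sx sy (o + s • uy)) =
      toComplex (proj ux uy sx sy o) + (s : ℂ) * Complex.I := by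
    intro o s
    simp only [toComplex, proj, add_dotProduct, smul_dotProduct, huy, dotProduct_comm uy ux, huxy,
      smul_eq_mul]
    push_cast; ring
  obtain ⟨o₀, ho₀⟩ := interior_body_nonempty hv
  obtain ⟨o, ho, hzo⟩ : ∃ o ∈ interior (body v),
      ∀ k, zVertex v ux uy sx sy k ≠ toComplex (proj ux uy sx sy o) := by
    obtain ⟨s, -, h⟩ := exists_generic_shift ho₀ ux one_ne_zero (hsx o₀)
    exact ⟨_, h⟩
  obtain ⟨s, hs, hox, hzox⟩ := exists_generic_shift ho ux one_ne_zero (hsx o)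
  obtain ⟨s', hs', hoy, hzoy⟩ := exists_generic_shift ho uy Complex.I_ne_zero (hsy o)
  have hsC : (s : ℂ) ≠ 0 := by exact_mod_cast hs.ne'
  have hsC' : (s' : ℂ) ≠ 0 := by exact_mod_cast hs'.ne'
  obtain ⟨hapex, hwx⟩ := apexWeight_eq_zero_and_coneWeight_eq hT hz ho hox hzo hzox (by
    rw [hsx, mul_one]; simpa using hsC)
  obtain ⟨-, hwy⟩ := apexWeight_eq_zero_and_coneWeight_eq hT hz ho hoy hzo hzoy (by
    rw [hsy]; simpa using hsC')
  rw [setIntegral_body_eq_coneWeight hT hz ho hzo hh, hapex, zero_mul, zero_add]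
  refine Finset.sum_congr rfl fun k _ => ?_
  congr 1
  set z := zVertex v ux uy sx sy with hzd
  have e0 := coneWeight_mul v z o T (hzo k)
  have ex := coneWeight_mul v z (o + s • ux) T (hzox k)
  have ey := coneWeight_mul v z (o + s' • uy) T (hzoy k)
  rw [← hwx, hsx] at ex
  rw [← hwy, hsy] at ey
  set ρ := coneWeight v z (toComplex (proj ux uy sx sy o)) o T k
  -- comparing two apices gives the value of the linear function of the apex on their difference
  have hA : ∀ (τ : ℝ) (u : Fin 3 → ℝ),
      ∑ t ∈ T, ((triNormal (v t.1) (v t.2.1) (v t.2.2) ⬝ᵥ (v k - (o + τ • u)) : ℝ) : ℂ) *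
        dividedWeight z t k =
      ∑ t ∈ T, ((triNormal (v t.1) (v t.2.1) (v t.2.2) ⬝ᵥ (v k - o) : ℝ) : ℂ) *
        dividedWeight z t k -
      τ * ∑ t ∈ T, ((triNormal (v t.1) (v t.2.1) (v t.2.2) ⬝ᵥ u : ℝ) : ℂ) *
        dividedWeight z t k := by
    intro τ u
    rw [Finset.mul_sum, ← Finset.sum_sub_distrib]
    refine Finset.sum_congr rfl fun t _ => ?_
    simp only [dotProduct_sub, dotProduct_add, dotProduct_smul, smul_eq_mul]
    push_cast; ring
  rw [hA, ← e0] at ex ey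
  have hx : ρ = ∑ t ∈ T, ((triNormal (v t.1) (v t.2.1) (v t.2.2) ⬝ᵥ ux : ℝ) : ℂ) *
        dividedWeight z t k := by
    refine mul_left_cancel₀ hsC ?_
    linear_combination -ex
  have hy : ρ * Complex.I = ∑ t ∈ T, ((triNormal (v t.1) (v t.2.1) (v t.2.2) ⬝ᵥ uy : ℝ) : ℂ) *
        dividedWeight z t k := by
    refine mul_left_cancel₀ hsC' ?_
    linear_combination -ey
  have hco : coeff v ux uy sx sy T k =
      (∑ t ∈ T, ((triNormal (v t.1) (v t.2.1) (v t.2.2) ⬝ᵥ ux : ℝ) : ℂ) * dividedWeight z t k -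
        Complex.I * ∑ t ∈ T, ((triNormal (v t.1) (v t.2.1) (v t.2.2) ⬝ᵥ uy : ℝ) : ℂ) *
          dividedWeight z t k) / 2 := by
    rw [Finset.mul_sum, ← Finset.sum_sub_distrib, Finset.sum_div]
    refine Finset.sum_congr rfl fun t _ => ?_
    simp only [flux, dividedWeight, hzd]
    ring
  rw [hco, ← hx, ← hy]
  linear_combination (ρ / 2) * Complex.I_mul_I

end ParallelBeam

end

theorem lemma1 {K : ℕ} (v : Fin K → Fin 3 → ℝ)
    -- the `v k` are the `K` distinct vertices of a polyhedron which is not flat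
    (hvert : ConvexIndependent ℝ v)
    (hnondeg : affineSpan ℝ (Set.range v) = ⊤)
    -- unit vectors along the window's edges, with unit projection direction `d`
    (ux uy d : Fin 3 → ℝ)
    (hux : ux ⬝ᵥ ux = 1) (huy : uy ⬝ᵥ uy = 1) (hd : d ⬝ᵥ d = 1) (hcross : ux ⨯₃ uy = d)
    -- no two vertices are projected to the same point
    (hcol : ∀ k k' : Fin K, k ≠ k' → ∀ a : ℝ, v k - v k' ≠ a • d)
    -- shifts, and a rectangular window which contains the projection
    (sx sy : ℝ) (c : ℝ × ℝ) (Rx Ry : ℝ)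
    (hwin : ParallelBeam.proj ux uy sx sy '' ParallelBeam.body v ⊆ ParallelBeam.window c Rx Ry) :
    ∃ ρ : Fin K → ℂ,
      (∀ h : ℂ → ℂ,
        AnalyticOnNhd ℂ h
          (ParallelBeam.toComplex '' (ParallelBeam.proj ux uy sx sy '' ParallelBeam.body v)) →
        MeasureTheory.IntegrableOn
          (fun p : ℝ × ℝ => (ParallelBeam.beam v ux uy sx sy p : ℂ) *
            iteratedDeriv 3 h (ParallelBeam.toComplex p))
          (ParallelBeam.window c Rx Ry) ∧
        ∫ p in ParallelBeam.window c Rx Ry, (ParallelBeam.beam v ux uy sx sy p : ℂ) *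
            iteratedDeriv 3 h (ParallelBeam.toComplex p) =
          ∑ k, ρ k * h (ParallelBeam.zVertex v ux uy sx sy k)) ∧
      -- the coefficients are explicit in terms of any triangulation of the boundary
      (∃ T, ParallelBeam.IsBoundaryTriangulation v T) ∧
      ∀ T, ParallelBeam.IsBoundaryTriangulation v T →
        ∀ k, ρ k = ParallelBeam.coeff v ux uy sx sy T k := by
  subst hcross
  have hz := ParallelBeam.zVertex_injective hux huy hd hcol sx sy
  have huxy := ParallelBeam.dotProduct_eq_zero_of_unit_cross hux huy hd
  obtain ⟨T₀, hT₀⟩ := ParallelBeam.exists_isBoundaryTriangulation hnondeg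
  refine ⟨ParallelBeam.coeff v ux uy sx sy T₀, fun h hh => ?_, ⟨T₀, hT₀⟩, fun T hT k => ?_⟩
  · rw [Set.image_image] at hh
    have hcont : ContinuousOn (fun r => iteratedDeriv 3 h (ParallelBeam.toComplex
        (ParallelBeam.proj ux uy sx sy r))) (ParallelBeam.body v) := fun r hr =>
      (ContinuousAt.comp (f := fun r => ParallelBeam.toComplex (ParallelBeam.proj ux uy sx sy r))
        (ParallelBeam.hasDerivAt_iteratedDeriv (hh _ ⟨r, hr, rfl⟩) 3).continuousAt
        (ParallelBeam.continuous_toComplex_proj ux uy sx sy).continuousAt).continuousWithinAt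
    obtain ⟨hint, heq⟩ := ParallelBeam.integrable_beam_mul v hux huy hd sx sy
      (f := fun p => iteratedDeriv 3 h (ParallelBeam.toComplex p)) hcont
    refine ⟨hint.integrableOn, ?_⟩
    rw [MeasureTheory.setIntegral_eq_integral_of_forall_compl_eq_zero, heq,
      ParallelBeam.setIntegral_body_eq_coeff hT₀ hnondeg hux huy huxy hz hh]
    intro p hp
    rw [ParallelBeam.beam_eq_zero v hux huy hd sx sy fun h => hp (hwin h)]
    simp
  · refine sub_eq_zero.1 (ParallelBeam.eq_zero_of_forall_polynomial hz
      (ρ := fun k => ParallelBeam.coeff v ux uy sx sy T₀ k - ParallelBeam.coeff v ux uy sx sy T k)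
      (fun p => ?_) k)
    have e₀ := ParallelBeam.setIntegral_body_eq_coeff hT₀ hnondeg hux huy huxy hz
      (ParallelBeam.analyticOnNhd_polynomial p _)
    have e := ParallelBeam.setIntegral_body_eq_coeff hT hnondeg hux huy huxy hz
      (ParallelBeam.analyticOnNhd_polynomial p _)
    simp only [sub_mul, Finset.sum_sub_distrib, ← e₀, ← e, sub_self]
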